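/- Let $X$ be a complex Banach space, let $\alpha\in\mathbb C$ with $0<\operatorname{Re}\alpha<1$, and let $A$ be a (not necessarily densely defined) linear operator in $X$ with domain $\mathcal D(A)$ that is non-negative, i.e. $(-\infty,0)\subseteq\rho(A)$ and $\sup_{\lambda>0}\|\lambda(\lambda+A)^{-1}\|<\infty$. Here $\rho(A)$ is the set of all $\lambda\in\mathbb C$ such that $\lambda-A$ has an everywhere defined bounded inverse. Let $D=\overline{\mathcal D(A)}$, let $A_D$ be the part of $A$ in $D$, i.e. $\mathcal D(A_D)=\{x\in\mathcal D(A)\cap D : Ax\in D\}$ and $A_Dx=Ax$, and suppose that $-A_D$ generates a bounded $C_0$-semigroup $(T(r))_{r\ge0}$ in $D$. Define the operator $J^\alpha_A$ in $X$ with domain $\mathcal D(A)$ by $$J^\alpha_Ax=\frac{\sin(\alpha\pi)}{\pi}\int_0^\infty t^{\alpha-1}(t+A)^{-1}Ax\,dt .$$ For $x\in D$ let $U(0)x=x$ and $$U(t)x=\frac1{\Gamma(\alpha)}\Bigl(\frac t2\Bigr)^{2\alpha}\int_0^\infty r^{-\alpha}e^{-t^2/(4r)}\,T(r)x\,\frac{dr}r\qquad(t>0),$$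 and define the operator $T_\alpha$ in $X$ by $$\mathcal D(T_\alpha)=\Bigl\{x\in D:\lim_{t\to0+}-t^{1-2\alpha}U'(t)x\text{ exists}\Bigr\},\qquad T_\alpha x=\lim_{t\to0+}-t^{1-2\alpha}U'(t)x .$$ Then $J^\alpha_A$ and $T_\alpha$ are closable, and their closures satisfy $$\overline{T_\alpha}=c_\alpha\,\overline{J^\alpha_A},\qquad c_\alpha=\frac{\Gamma(1-\alpha)}{2^{2\alpha-1}\,\Gamma(\alpha)}$$ (equality of operators, including their domains). -/

import Mathlib

open Set Filter Topology MeasureTheory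

noncomputable section

namespace FracPow

/-! ## Unbounded operators: bounded inverse, resolvent set, non-negativity, part -/

section Operators

variable {X : Type*} [NormedAddCommGroup X] [NormedSpace ℂ X]

/-- The operator `z + A` (that is, `x ↦ z • x + A x`) with domain `𝒟(A)`. -/
def shift (z : ℂ) (A : X →ₗ.[ℂ] X) : X →ₗ.[ℂ] X :=
  (z • (LinearMap.id : X →ₗ[ℂ] X)) +ᵥ A

/-- `R` is an everywhere defined bounded two-sided inverse of the unbounded operator `B`. -/
structure IsBoundedInverse (B : X →ₗ.[ℂ] X) (R : X →L[ℂ] X) : Prop where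
  mem_domain : ∀ y, R y ∈ B.domain
  right_inv : ∀ y, B ⟨R y, mem_domain y⟩ = y
  left_inv : ∀ x : B.domain, R (B x) = x

open Classical in
/-- `B⁻¹` as an element of `L(X)`, if `B` has such an inverse (and `0` otherwise). -/
def boundedInverse (B : X →ₗ.[ℂ] X) : X →L[ℂ] X :=
  if h : ∃ R, IsBoundedInverse B R then h.choose else 0

/-- The resolvent set `ρ(A)`: all `z` such that `z - A` has an inverse in `L(X)`. -/
def resolventSet (A : X →ₗ.[ℂ] X) : Set ℂ :=
  {z | ∃ R, IsBoundedInverse (shift z (-A)) R}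

/-- `A` is non-negative: `(-∞, 0) ⊆ ρ(A)` and `sup_{t > 0} ‖t (t + A)⁻¹‖ < ∞`. -/
structure IsNonnegative (A : X →ₗ.[ℂ] X) : Prop where
  neg_mem_resolventSet : ∀ t : ℝ, 0 < t → (-t : ℂ) ∈ resolventSet A
  bounded : ∃ M : ℝ, ∀ t : ℝ, 0 < t → ‖(t : ℂ) • boundedInverse (shift (t : ℂ) A)‖ ≤ M

/-- The part of `A` in the subspace `D`, as an operator in the space `D`:
its domain is `{x ∈ 𝒟(A) ∩ D | A x ∈ D}`. -/
def part (A : X →ₗ.[ℂ] X) (D : Submodule ℂ X) : D →ₗ.[ℂ] D where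
  domain :=
    { carrier := {x | ∃ h : (x : X) ∈ A.domain, A ⟨x, h⟩ ∈ D}
      zero_mem' := ⟨A.domain.zero_mem, by
        have : A ⟨((0 : D) : X), A.domain.zero_mem⟩ = 0 := A.map_zero
        rw [this]; exact D.zero_mem⟩
      add_mem' := by
        rintro x y ⟨hx, hx'⟩ ⟨hy, hy'⟩
        refine ⟨A.domain.add_mem hx hy, ?_⟩
        have := A.map_add ⟨x, hx⟩ ⟨y, hy⟩
        exact this ▸ D.add_mem hx' hy'
      smul_mem' := by
        rintro c x ⟨hx, hx'⟩
        refine ⟨A.domain.smul_mem c hx, ?_⟩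
        have := A.map_smul c ⟨x, hx⟩
        exact this ▸ D.smul_mem c hx' }
  toFun :=
    { toFun := fun x => ⟨A ⟨((x : D) : X), x.2.1⟩, x.2.2⟩
      map_add' := fun x y => Subtype.ext (A.map_add ⟨_, x.2.1⟩ ⟨_, y.2.1⟩)
      map_smul' := fun c x => Subtype.ext (A.map_smul c ⟨_, x.2.1⟩) }

theorem IsBoundedInverse.neg {B : X →ₗ.[ℂ] X} {R : X →L[ℂ] X} (h : IsBoundedInverse B R) :
    IsBoundedInverse (-B) (-R) where
  mem_domain y := B.domain.neg_mem (h.mem_domain y)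
  right_inv y := by
    have := B.map_neg ⟨R y, h.mem_domain y⟩
    rw [h.right_inv] at this
    rw [LinearPMap.neg_apply, neg_eq_iff_eq_neg]
    exact this
  left_inv x := by
    have := h.left_inv x
    simp [LinearPMap.neg_apply, this]

theorem shift_neg_neg (t : ℂ) (A : X →ₗ.[ℂ] X) : -(shift (-t) (-A)) = shift t A := by
  refine LinearPMap.ext rfl ?_
  intro x hx hx'
  simp [shift, LinearPMap.vadd_apply, LinearPMap.neg_apply, add_comm]

theorem isBoundedInverse_boundedInverse {B : X →ₗ.[ℂ] X} (h : ∃ R, IsBoundedInverse B R) :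
    IsBoundedInverse B (boundedInverse B) := by
  rw [boundedInverse, dif_pos h]
  exact h.choose_spec

theorem IsNonnegative.isBoundedInverse {A : X →ₗ.[ℂ] X} (hA : IsNonnegative A) {t : ℝ}
    (ht : 0 < t) : IsBoundedInverse (shift (t : ℂ) A) (boundedInverse (shift (t : ℂ) A)) := by
  obtain ⟨R, hR⟩ := hA.neg_mem_resolventSet t ht
  apply isBoundedInverse_boundedInverse
  have := hR.neg
  rw [shift_neg_neg] at this
  exact ⟨_, this⟩

theorem IsBoundedInverse.apply_eq {A : X →ₗ.[ℂ] X} {z : ℂ} {R : X →L[ℂ] X}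
    (h : IsBoundedInverse (shift z A) R) (x : A.domain) :
    R (A x) = (x : X) - z • R x := by
  have := h.left_inv x
  rw [eq_sub_iff_add_eq, add_comm, ← map_smul, ← map_add]
  exact this

theorem IsBoundedInverse.sub_eq {A : X →ₗ.[ℂ] X} {z w : ℂ} {R S : X →L[ℂ] X}
    (hR : IsBoundedInverse (shift z A) R) (hS : IsBoundedInverse (shift w A) S) (y : X) :
    R y - S y = (w - z) • R (S y) := by
  have h1 : w • S y + A ⟨S y, hS.mem_domain y⟩ = y := hS.right_inv y
  have h2 := hR.apply_eq ⟨S y, hS.mem_domain y⟩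
  have h3 : R y = w • R (S y) + R (A ⟨S y, hS.mem_domain y⟩) := by
    rw [← map_smul, ← map_add, h1]
  rw [h3, h2, sub_smul]
  abel

theorem IsNonnegative.exists_bound {A : X →ₗ.[ℂ] X} (hA : IsNonnegative A) :
    ∃ M : ℝ, 0 ≤ M ∧ ∀ t : ℝ, 0 < t → ∀ y,
      ‖boundedInverse (shift (t : ℂ) A) y‖ ≤ M / t * ‖y‖ := by
  obtain ⟨M, hM⟩ := hA.bounded
  refine ⟨M, (norm_nonneg _).trans (hM 1 one_pos), fun t ht y => ?_⟩
  have h := hM t ht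
  rw [norm_smul, Complex.norm_real, Real.norm_of_nonneg ht.le] at h
  refine (ContinuousLinearMap.le_opNorm _ y).trans ?_
  gcongr
  rw [le_div_iff₀ ht, mul_comm]
  exact h

theorem IsNonnegative.continuousOn {A : X →ₗ.[ℂ] X} (hA : IsNonnegative A) (y : X) :
    ContinuousOn (fun t : ℝ => boundedInverse (shift (t : ℂ) A) y) (Ioi 0) := by
  obtain ⟨M, hM0, hM⟩ := hA.exists_bound
  intro s hs
  have hs : 0 < s := hs
  refine ContinuousAt.continuousWithinAt ?_
  rw [ContinuousAt, tendsto_iff_norm_sub_tendsto_zero]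
  set S := boundedInverse (shift (s : ℂ) A) with hS
  have hlim : Tendsto (fun t : ℝ => |s - t| * (M / t * ‖S y‖)) (𝓝 s) (𝓝 0) := by
    have : ContinuousAt (fun t : ℝ => |s - t| * (M / t * ‖S y‖)) s := by
      have := hs.ne'
      fun_prop (disch := assumption)
    simpa [ContinuousAt] using this
  refine squeeze_zero' (Eventually.of_forall fun _ => norm_nonneg _) ?_ hlim
  filter_upwards [lt_mem_nhds hs] with t ht
  rw [(hA.isBoundedInverse ht).sub_eq (hA.isBoundedInverse hs) y, norm_smul]
  gcongr
  · rw [← Complex.ofReal_sub, Complex.norm_real, Real.norm_eq_abs]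
  · exact hM t ht _

/-- The Balakrishnan integral converges in the Bochner sense on `𝒟(A)`. -/
theorem IsNonnegative.integrableOn_balakrishnan {A : X →ₗ.[ℂ] X} (hA : IsNonnegative A) {α : ℂ}
    (h₀ : 0 < α.re) (h₁ : α.re < 1) (x : A.domain) :
    IntegrableOn (fun t : ℝ => (t : ℂ) ^ (α - 1) • boundedInverse (shift (t : ℂ) A) (A x))
      (Ioi 0) := by
  obtain ⟨M, hM0, hM⟩ := hA.exists_bound
  have hcont : ContinuousOn
      (fun t : ℝ => (t : ℂ) ^ (α - 1) • boundedInverse (shift (t : ℂ) A) (A x)) (Ioi 0) := by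
    refine ContinuousOn.smul (fun t ht => ?_) (hA.continuousOn _)
    exact (Complex.continuousAt_ofReal_cpow_const t (α - 1)
      (Or.inr (ne_of_gt ht))).continuousWithinAt
  have hmeas := hcont.aestronglyMeasurable (μ := volume) measurableSet_Ioi
  rw [← Ioc_union_Ioi_eq_Ioi (zero_le_one (α := ℝ))]
  refine IntegrableOn.union ?_ ?_
  · have hint : IntegrableOn (fun t : ℝ => t ^ (α.re - 1) * ((1 + M) * ‖(x : X)‖)) (Ioc 0 1) := by
      refine Integrable.mul_const ?_ _
      have := (intervalIntegral.intervalIntegrable_rpow' (a := 0) (b := 1) (r := α.re - 1)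
        (by linarith))
      rwa [intervalIntegrable_iff_integrableOn_Ioc_of_le zero_le_one] at this
    refine Integrable.mono' hint (hmeas.mono_measure
      (Measure.restrict_mono Ioc_subset_Ioi_self le_rfl)) ?_
    refine ae_restrict_of_forall_mem measurableSet_Ioc fun t ht => ?_
    have ht0 : 0 < t := ht.1
    rw [norm_smul, Complex.norm_cpow_eq_rpow_re_of_pos ht0]
    simp only [Complex.sub_re, Complex.one_re]
    gcongr
    rw [(hA.isBoundedInverse ht0).apply_eq x]
    refine (norm_sub_le _ _).trans ?_
    rw [add_mul, one_mul, norm_smul, Complex.norm_real, Real.norm_of_nonneg ht0.le]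
    refine add_le_add le_rfl ?_
    calc t * ‖boundedInverse (shift (t : ℂ) A) (x : X)‖ ≤ t * (M / t * ‖(x : X)‖) := by
          gcongr; exact hM t ht0 _
      _ = M * ‖(x : X)‖ := by field_simp
  · have hint : IntegrableOn (fun t : ℝ => t ^ (α.re - 2) * (M * ‖A x‖)) (Ioi 1) :=
      Integrable.mul_const (integrableOn_Ioi_rpow_of_lt (by linarith) one_pos) _
    refine Integrable.mono' hint (hmeas.mono_measure
      (Measure.restrict_mono (Ioi_subset_Ioi zero_le_one) le_rfl)) ?_
    refine ae_restrict_of_forall_mem measurableSet_Ioi fun t ht => ?_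
    have ht0 : 0 < t := zero_lt_one.trans ht
    rw [norm_smul, Complex.norm_cpow_eq_rpow_re_of_pos ht0]
    simp only [Complex.sub_re, Complex.one_re]
    calc t ^ (α.re - 1) * ‖boundedInverse (shift (t : ℂ) A) (A x)‖
        ≤ t ^ (α.re - 1) * (M / t * ‖A x‖) := by gcongr; exact hM t ht0 _
      _ = t ^ (α.re - 2) * (M * ‖A x‖) := by
          rw [show α.re - 1 = (α.re - 2) + 1 by ring, Real.rpow_add_one ht0.ne']
          field_simp

/-- The operator `J^α_A` with domain `𝒟(A)`,
`J^α_A x = sin(α π) / π * ∫_0^∞ t^(α - 1) (t + A)⁻¹ A x dt`. Its closure is the Balakrishnan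
operator. -/
def balakrishnan (A : X →ₗ.[ℂ] X) (hA : IsNonnegative A) (α : ℂ) (h₀ : 0 < α.re)
    (h₁ : α.re < 1) : X →ₗ.[ℂ] X where
  domain := A.domain
  toFun :=
    { toFun := fun x => (Complex.sin (α * Real.pi) / Real.pi) •
        ∫ t : ℝ in Ioi 0, (t : ℂ) ^ (α - 1) • boundedInverse (shift (t : ℂ) A) (A x)
      map_add' := fun x y => by
        rw [← smul_add, ← integral_add (hA.integrableOn_balakrishnan h₀ h₁ x)
          (hA.integrableOn_balakrishnan h₀ h₁ y)]
        congr 2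
        funext t
        rw [A.map_add, map_add, smul_add]
      map_smul' := fun c x => by
        rw [RingHom.id_apply, smul_comm c, ← integral_smul c]
        congr 2
        funext t
        rw [A.map_smul, map_smul, smul_comm] }

end Operators

/-! ## Strongly continuous semigroups -/

section Semigroups

variable {E : Type*} [NormedAddCommGroup E] [NormedSpace ℂ E]

/-- `(T(t))_{t ≥ 0}` is a bounded `C₀`-semigroup in `E` (only the values of `T` on `[0, ∞)`
matter). -/
structure IsBoundedC0Semigroup (T : ℝ → E →L[ℂ] E) : Prop where
  apply_zero : T 0 = ContinuousLinearMap.id ℂ E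
  apply_add : ∀ s t : ℝ, 0 ≤ s → 0 ≤ t → T (s + t) = (T s).comp (T t)
  continuousOn : ∀ x, ContinuousOn (fun t => T t x) (Ici 0)
  bounded : ∃ M : ℝ, ∀ t : ℝ, 0 ≤ t → ‖T t‖ ≤ M

/-- The generator of `(T(t))_{t ≥ 0}`: `x ↦ lim_{h → 0+} (T(h) x - x) / h`, the domain being the
set of all `x` for which this limit exists. -/
def generator (T : ℝ → E →L[ℂ] E) : E →ₗ.[ℂ] E where
  domain :=
    { carrier := {x | ∃ y, Tendsto (fun h : ℝ => (h : ℂ)⁻¹ • (T h x - x)) (𝓝[>] 0) (𝓝 y)}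
      zero_mem' := ⟨0, by simp⟩
      add_mem' := by
        rintro x y ⟨x', hx⟩ ⟨y', hy⟩
        refine ⟨x' + y', (hx.add hy).congr fun h => ?_⟩
        rw [← smul_add, map_add]; congr 1; abel
      smul_mem' := by
        rintro c x ⟨x', hx⟩
        refine ⟨c • x', (hx.const_smul c).congr fun h => ?_⟩
        rw [smul_comm, smul_sub, map_smul] }
  toFun :=
    { toFun := fun x => x.2.choose
      map_add' := fun x y => by
        refine tendsto_nhds_unique (x + y).2.choose_spec
          ((x.2.choose_spec.add y.2.choose_spec).congr fun h => ?_)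
        rw [← smul_add, Submodule.coe_add, map_add]; congr 1; abel
      map_smul' := fun c x => by
        refine tendsto_nhds_unique (c • x).2.choose_spec
          ((x.2.choose_spec.const_smul c).congr fun h => ?_)
        rw [smul_comm, smul_sub, Submodule.coe_smul, map_smul] }

/-- The family `U(t)`, subordinated to `(T(r))_{r ≥ 0}`: `U(0) x = x` and, for `t > 0`,
`U(t) x = 1 / Γ(α) * (t / 2)^(2α) * ∫_0^∞ r^(-α) exp(-t² / (4r)) T(r) x dr / r`. -/
def subordination (T : ℝ → E →L[ℂ] E) (α : ℂ) (t : ℝ) (x : E) : E :=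
  if t = 0 then x
  else (1 / Complex.Gamma α * ((t / 2 : ℝ) : ℂ) ^ (2 * α)) •
    ∫ r : ℝ in Ioi 0, ((r : ℂ) ^ (-α) * (Real.exp (-(t ^ 2 / (4 * r))) : ℂ) / (r : ℂ)) • T r x

theorem norm_kernel (α : ℂ) (t : ℝ) {r : ℝ} (hr : 0 < r) :
    ‖(r : ℂ) ^ (-α) * (Real.exp (-(t ^ 2 / (4 * r))) : ℂ) / (r : ℂ)‖ =
      r ^ (-α.re - 1) * Real.exp (-(t ^ 2 / 4 / r)) := by
  rw [norm_div, norm_mul, Complex.norm_cpow_eq_rpow_re_of_pos hr, Complex.norm_real,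
    Complex.norm_real, Real.norm_of_nonneg hr.le, Real.norm_of_nonneg (Real.exp_pos _).le,
    Real.rpow_sub_one hr.ne', Complex.neg_re, div_div]
  ring

theorem integrableOn_rpow_mul_exp_neg_div {b c : ℝ} (hb : 0 < b) (hc : 0 < c) :
    IntegrableOn (fun r : ℝ => r ^ (-b - 1) * Real.exp (-(c / r))) (Ioi 0) := by
  have h := integrableOn_rpow_mul_exp_neg_mul_rpow (p := 1) (s := b - 1) (b := c)
    (by linarith) one_pos hc
  rw [← integrableOn_Ioi_comp_rpow_iff' _ (p := -1) (by norm_num)] at h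
  refine h.congr_fun (fun r hr => ?_) measurableSet_Ioi
  have hr : 0 < r := hr
  simp only [Real.rpow_one, smul_eq_mul]
  rw [← mul_assoc, ← Real.rpow_mul hr.le, ← Real.rpow_add hr, Real.rpow_neg_one]
  congr 2
  · ring
  · ring

theorem continuousOn_kernel (α : ℂ) (t : ℝ) :
    ContinuousOn (fun r : ℝ =>
      (r : ℂ) ^ (-α) * (Real.exp (-(t ^ 2 / (4 * r))) : ℂ) / (r : ℂ)) (Ioi 0) := by
  refine ContinuousOn.div (ContinuousOn.mul (fun r hr => ?_) ?_)
    Complex.continuous_ofReal.continuousOn ?_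
  · exact (Complex.continuousAt_ofReal_cpow_const r (-α)
      (Or.inr (ne_of_gt hr))).continuousWithinAt
  · refine Complex.continuous_ofReal.comp_continuousOn (Real.continuous_exp.comp_continuousOn ?_)
    refine (continuousOn_const.div (by fun_prop) ?_).neg
    intro r hr
    have : 0 < r := hr
    positivity
  · intro r hr
    exact_mod_cast (ne_of_gt hr)

theorem IsBoundedC0Semigroup.exists_bound {T : ℝ → E →L[ℂ] E} (hT : IsBoundedC0Semigroup T) :
    ∃ M : ℝ, 0 ≤ M ∧ ∀ t : ℝ, 0 ≤ t → ∀ x, ‖T t x‖ ≤ M * ‖x‖ := by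
  obtain ⟨M, hM⟩ := hT.bounded
  exact ⟨M, (norm_nonneg _).trans (hM 0 le_rfl), fun t ht x => (T t).le_of_opNorm_le (hM t ht) x⟩

/-- The integral that defines `U(t) x` converges in the Bochner sense. -/
theorem IsBoundedC0Semigroup.integrableOn_kernel {T : ℝ → E →L[ℂ] E}
    (hT : IsBoundedC0Semigroup T) {α : ℂ} (h₀ : 0 < α.re) {t : ℝ} (ht : 0 < t) (x : E) :
    IntegrableOn (fun r : ℝ =>
      ((r : ℂ) ^ (-α) * (Real.exp (-(t ^ 2 / (4 * r))) : ℂ) / (r : ℂ)) • T r x) (Ioi 0) := by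
  obtain ⟨M, hM0, hM⟩ := hT.exists_bound
  have hcont := (continuousOn_kernel α t).smul ((hT.continuousOn x).mono Ioi_subset_Ici_self)
  refine Integrable.mono' ((integrableOn_rpow_mul_exp_neg_div h₀
    (c := t ^ 2 / 4) (by positivity)).mul_const (M * ‖x‖))
    (hcont.aestronglyMeasurable measurableSet_Ioi) ?_
  refine ae_restrict_of_forall_mem measurableSet_Ioi fun r hr => ?_
  have hr : 0 < r := hr
  rw [norm_smul, norm_kernel α t hr]
  gcongr
  exact hM r hr.le x

/-- `t ↦ U(t) x` is differentiable on `(0, ∞)`. -/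
theorem IsBoundedC0Semigroup.differentiableAt_subordination {T : ℝ → E →L[ℂ] E}
    (hT : IsBoundedC0Semigroup T) {α : ℂ} (h₀ : 0 < α.re) {t : ℝ} (ht : 0 < t) (x : E) :
    DifferentiableAt ℝ (fun s => subordination T α s x) t := by
  obtain ⟨M, hM0, hM⟩ := hT.exists_bound
  set k : ℝ → ℝ → ℂ := fun s r =>
    (r : ℂ) ^ (-α) * (Real.exp (-(s ^ 2 / (4 * r))) : ℂ) / (r : ℂ) with hk
  have hloc : (fun s => subordination T α s x) =ᶠ[𝓝 t] fun s =>
      (1 / Complex.Gamma α * ((s / 2 : ℝ) : ℂ) ^ (2 * α)) • ∫ r : ℝ in Ioi 0, k s r • T r x := by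
    filter_upwards [lt_mem_nhds ht] with s hs
    rw [subordination, if_neg hs.ne']
  refine DifferentiableAt.congr_of_eventuallyEq ?_ hloc
  refine DifferentiableAt.smul ?_ ?_
  · refine DifferentiableAt.const_mul ?_ _
    have h1 : DifferentiableAt ℝ (fun s : ℝ => ((s / 2 : ℝ) : ℂ)) t := by
      have := (((hasDerivAt_id t).div_const 2).ofReal_comp).differentiableAt
      simpa using this
    have h2 : DifferentiableAt ℂ (fun z : ℂ => z ^ (2 * α)) ((t / 2 : ℝ) : ℂ) := by
      refine (Complex.hasStrictDerivAt_cpow_const ?_).hasDerivAt.differentiableAt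
      exact Complex.ofReal_mem_slitPlane.2 (by positivity)
    exact (h2.restrictScalars ℝ).comp t h1
  · have hder : ∀ r : ℝ, 0 < r → ∀ s : ℝ, HasDerivAt (fun s => k s r • T r x)
        ((k s r * ((-(s / (2 * r)) : ℝ) : ℂ)) • T r x) s := by
      intro r hr s
      refine HasDerivAt.smul_const ?_ _
      have h1 : HasDerivAt (fun s : ℝ => Real.exp (-(s ^ 2 / (4 * r))))
          (Real.exp (-(s ^ 2 / (4 * r))) * (-(s / (2 * r)))) s := by
        have := (((hasDerivAt_pow 2 s).div_const (4 * r)).neg).exp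
        refine this.congr_deriv ?_
        simp only [Pi.neg_apply, Nat.cast_ofNat, Nat.add_one_sub_one, pow_one]
        congr 2
        field_simp; ring
      have h2 := ((h1.ofReal_comp).const_mul ((r : ℂ) ^ (-α))).div_const (r : ℂ)
      convert h2 using 1
      simp only [hk]; push_cast; ring
    have hcont : ∀ s : ℝ, ContinuousOn (fun r => k s r • T r x) (Ioi 0) := fun s =>
      (continuousOn_kernel α s).smul ((hT.continuousOn x).mono Ioi_subset_Ici_self)
    have hball : Metric.ball t (t / 2) ∈ 𝓝 t := Metric.ball_mem_nhds t (by positivity)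
    refine (hasDerivAt_integral_of_dominated_loc_of_deriv_le
      (F := fun s r => k s r • T r x)
      (F' := fun s r => (k s r * ((-(s / (2 * r)) : ℝ) : ℂ)) • T r x)
      (bound := fun r => (r ^ (-(α.re + 1) - 1) * Real.exp (-(t ^ 2 / 16 / r))) * (t * (M * ‖x‖)))
      hball ?_ (hT.integrableOn_kernel h₀ ht x) ?_ ?_ ?_ ?_).2.differentiableAt
    · exact Eventually.of_forall fun s => (hcont s).aestronglyMeasurable measurableSet_Ioi
    · refine ContinuousOn.aestronglyMeasurable ?_ measurableSet_Ioi
      refine ((continuousOn_kernel α t).mul ?_).smul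
        ((hT.continuousOn x).mono Ioi_subset_Ici_self)
      refine Complex.continuous_ofReal.comp_continuousOn ?_
      refine (continuousOn_const.div (by fun_prop) ?_).neg
      intro r hr
      have : 0 < r := hr
      positivity
    · refine ae_restrict_of_forall_mem measurableSet_Ioi fun r hr s hs => ?_
      have hr : 0 < r := hr
      rw [Metric.mem_ball, Real.dist_eq, abs_lt] at hs
      have hs1 : t / 2 < s := by linarith
      have hs2 : s < 2 * t := by linarith
      have hs0 : 0 < s := by linarith
      rw [norm_smul, norm_mul, norm_kernel α s hr, Complex.norm_real, norm_neg,
        Real.norm_of_nonneg (by positivity)]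
      have e1 : Real.exp (-(s ^ 2 / 4 / r)) ≤ Real.exp (-(t ^ 2 / 16 / r)) := by
        apply Real.exp_le_exp.2
        apply neg_le_neg
        refine div_le_div_of_nonneg_right ?_ hr.le
        nlinarith
      have e2 : s / (2 * r) ≤ t / r := by
        rw [div_le_div_iff₀ (by positivity) hr]; nlinarith
      calc r ^ (-α.re - 1) * Real.exp (-(s ^ 2 / 4 / r)) * (s / (2 * r)) * ‖T r x‖
          ≤ r ^ (-α.re - 1) * Real.exp (-(t ^ 2 / 16 / r)) * (t / r) * (M * ‖x‖) := by
            gcongr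
            exact hM r hr.le x
        _ = _ := by
            rw [show -(α.re + 1) - 1 = (-α.re - 1) - 1 by ring, Real.rpow_sub_one hr.ne' (-α.re - 1)]
            ring
    · exact (integrableOn_rpow_mul_exp_neg_div (by linarith) (by positivity)).mul_const _
    · exact ae_restrict_of_forall_mem measurableSet_Ioi fun r hr s _ => hder r hr s

theorem IsBoundedC0Semigroup.subordination_add {T : ℝ → E →L[ℂ] E}
    (hT : IsBoundedC0Semigroup T) {α : ℂ} (h₀ : 0 < α.re) {t : ℝ} (ht : 0 < t) (x y : E) :
    subordination T α t (x + y) = subordination T α t x + subordination T α t y := by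
  simp only [subordination, if_neg ht.ne']
  rw [← smul_add, ← integral_add (hT.integrableOn_kernel h₀ ht x)
    (hT.integrableOn_kernel h₀ ht y)]
  congr 2
  funext r
  rw [map_add, smul_add]

theorem subordination_smul (T : ℝ → E →L[ℂ] E) (α : ℂ) (t : ℝ) (c : ℂ) (x : E) :
    subordination T α t (c • x) = c • subordination T α t x := by
  unfold subordination
  split_ifs
  · rfl
  · rw [smul_comm c, ← integral_smul c]
    congr 2
    funext r
    rw [map_smul, smul_comm]

theorem IsBoundedC0Semigroup.deriv_subordination_add {T : ℝ → E →L[ℂ] E}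
    (hT : IsBoundedC0Semigroup T) {α : ℂ} (h₀ : 0 < α.re) {t : ℝ} (ht : 0 < t) (x y : E) :
    deriv (fun s => subordination T α s (x + y)) t =
      deriv (fun s => subordination T α s x) t + deriv (fun s => subordination T α s y) t := by
  rw [← deriv_fun_add (hT.differentiableAt_subordination h₀ ht x)
    (hT.differentiableAt_subordination h₀ ht y)]
  refine EventuallyEq.deriv_eq ?_
  filter_upwards [lt_mem_nhds ht] with s hs
  exact hT.subordination_add h₀ hs x y

theorem IsBoundedC0Semigroup.deriv_subordination_smul {T : ℝ → E →L[ℂ] E}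
    (hT : IsBoundedC0Semigroup T) {α : ℂ} (h₀ : 0 < α.re) {t : ℝ} (ht : 0 < t) (c : ℂ) (x : E) :
    deriv (fun s => subordination T α s (c • x)) t =
      c • deriv (fun s => subordination T α s x) t := by
  have h := (hT.differentiableAt_subordination h₀ ht x).hasDerivAt.const_smul c
  simp only [subordination_smul]
  exact h.deriv

end Semigroups

/-! ## The Dirichlet-to-Neumann operator -/

section DirichletToNeumann

variable {X : Type*} [NormedAddCommGroup X] [NormedSpace ℂ X]

/-- The expression `-t^(1 - 2α) U'(t) x`, as an element of `X`. -/
def neumannData {D : Submodule ℂ X} (T : ℝ → D →L[ℂ] D) (α : ℂ) (x : D) (t : ℝ) : X :=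
  -((t : ℂ) ^ (1 - 2 * α) • (deriv (fun s => subordination T α s x) t : D))

theorem neumannData_add {D : Submodule ℂ X} {T : ℝ → D →L[ℂ] D} (hT : IsBoundedC0Semigroup T)
    {α : ℂ} (h₀ : 0 < α.re) (x y : D) {t : ℝ} (ht : 0 < t) :
    neumannData T α x t + neumannData T α y t = neumannData T α (x + y) t := by
  simp only [neumannData, hT.deriv_subordination_add h₀ ht, smul_add, neg_add, Submodule.coe_add]

theorem neumannData_smul {D : Submodule ℂ X} {T : ℝ → D →L[ℂ] D} (hT : IsBoundedC0Semigroup T)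
    {α : ℂ} (h₀ : 0 < α.re) (c : ℂ) (x : D) {t : ℝ} (ht : 0 < t) :
    c • neumannData T α x t = neumannData T α (c • x) t := by
  simp only [neumannData, hT.deriv_subordination_smul h₀ ht, Submodule.coe_smul, smul_neg]
  rw [smul_comm]

/-- The operator `T_α` in `X`: its domain is the set of all `x ∈ D` for which
`lim_{t → 0+} -t^(1 - 2α) U'(t) x` exists, and `T_α x` is this limit. Its closure is the
generalised Dirichlet-to-Neumann operator. -/
def dirichletToNeumann {D : Submodule ℂ X} (T : ℝ → D →L[ℂ] D) (hT : IsBoundedC0Semigroup T)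
    (α : ℂ) (h₀ : 0 < α.re) : X →ₗ.[ℂ] X where
  domain :=
    { carrier := {x | ∃ hx : x ∈ D, ∃ y : X,
        Tendsto (neumannData T α ⟨x, hx⟩) (𝓝[>] 0) (𝓝 y)}
      zero_mem' := by
        refine ⟨D.zero_mem, 0, tendsto_const_nhds.congr' ?_⟩
        filter_upwards [self_mem_nhdsWithin] with t ht
        have := neumannData_smul hT h₀ 0 0 (t := t) ht
        rw [zero_smul, zero_smul] at this
        exact this
      add_mem' := by
        rintro x y ⟨hx, x', hx'⟩ ⟨hy, y', hy'⟩
        refine ⟨D.add_mem hx hy, x' + y', (hx'.add hy').congr' ?_⟩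
        filter_upwards [self_mem_nhdsWithin] with t ht
        exact neumannData_add hT h₀ _ _ ht
      smul_mem' := by
        rintro c x ⟨hx, x', hx'⟩
        refine ⟨D.smul_mem c hx, c • x', (hx'.const_smul c).congr' ?_⟩
        filter_upwards [self_mem_nhdsWithin] with t ht
        exact neumannData_smul hT h₀ c _ ht }
  toFun :=
    { toFun := fun x => x.2.choose_spec.choose
      map_add' := fun x y => by
        refine tendsto_nhds_unique (x + y).2.choose_spec.choose_spec
          ((x.2.choose_spec.choose_spec.add y.2.choose_spec.choose_spec).congr' ?_)
        filter_upwards [self_mem_nhdsWithin] with t ht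
        exact neumannData_add hT h₀ _ _ ht
      map_smul' := fun c x => by
        refine tendsto_nhds_unique (c • x).2.choose_spec.choose_spec
          ((x.2.choose_spec.choose_spec.const_smul c).congr' ?_)
        filter_upwards [self_mem_nhdsWithin] with t ht
        exact neumannData_smul hT h₀ c _ ht }

end DirichletToNeumann

end FracPow

end

/-! On $\mathcal D(A_D)$ both operators are given, up to constants, by the integral
$I(x)=\int_0^\infty r^{-\alpha-1}(x-T(r)x)\,dr$, which converges there because
$\|x-T(r)x\|=O(\min(r,1))$.

For the Neumann side, differentiating $U$ gives $T(r)x$ integrated against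
$k_t(r)(2\alpha-t^2/(2r))$, with $k_t(r)=r^{-\alpha-1}e^{-t^2/(4r)}$. This weight has total integral
zero, so $T(r)x$ may be replaced by $T(r)x-x$, and dominated convergence as $t\to0+$ gives a
multiple of $I(x)$ (`tendsto_smul_deriv_subordination`). For the Balakrishnan side,
$(t+A)^{-1}Ax=x-t(t+A)^{-1}x$; on $D$ the resolvent is the Laplace transform of the semigroup, and
Fubini again gives a multiple of $I(x)$ (`integral_cpow_smul_sub_laplace`). Euler's reflection
formula matches the constants.

To pass to closures, note that each $R_s=(s+A)^{-1}$ commutes with both operators and maps $D$ into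
$\mathcal D(A_D)$, while $sR_s\to1$ strongly on $D$ as $s\to\infty$. So a pair $(x,y)$ in either
graph is the limit of the pairs $(sR_sx,sR_sy)$, to which the identity on $\mathcal D(A_D)$ applies.
Closability of $J^\alpha_A$ holds because $J^\alpha_AR_1$ is bounded and $R_1$ is injective. That of
$T_\alpha$ then comes for free: the closure of its graph is the graph of
$c_\alpha\overline{J^\alpha_A}$. -/

noncomputable section

namespace FracPow

/-! ### Laplace transform of a bounded semigroup. -/

section Laplace

variable {E : Type*} [NormedAddCommGroup E] [NormedSpace ℂ E]

/-- The Laplace transform `∫_0^∞ e^(-l r) T(r) x dr` of the orbit of `x`. -/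
def laplace (T : ℝ → E →L[ℂ] E) (l : ℝ) (x : E) : E :=
  ∫ r : ℝ in Ioi 0, (Real.exp (-(l * r)) : ℂ) • T r x

variable {T : ℝ → E →L[ℂ] E}

theorem IsBoundedC0Semigroup.continuousOn_exp_smul (hT : IsBoundedC0Semigroup T) (l : ℝ) (x : E) :
    ContinuousOn (fun r : ℝ => (Real.exp (-(l * r)) : ℂ) • T r x) (Ici 0) := by
  refine ContinuousOn.smul ?_ (hT.continuousOn x)
  fun_prop

theorem IsBoundedC0Semigroup.integrableOn_exp_smul (hT : IsBoundedC0Semigroup T) {l : ℝ}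
    (hl : 0 < l) (x : E) :
    IntegrableOn (fun r : ℝ => (Real.exp (-(l * r)) : ℂ) • T r x) (Ioi 0) := by
  obtain ⟨M, hM0, hM⟩ := hT.exists_bound
  refine Integrable.mono' ((exp_neg_integrableOn_Ioi 0 hl).mul_const (M * ‖x‖))
    (((hT.continuousOn_exp_smul l x).mono Ioi_subset_Ici_self).aestronglyMeasurable
      measurableSet_Ioi) ?_
  refine ae_restrict_of_forall_mem measurableSet_Ioi fun r hr => ?_
  rw [norm_smul, Complex.norm_real, Real.norm_of_nonneg (Real.exp_pos _).le, neg_mul]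
  gcongr
  exact hM r (le_of_lt hr) x

theorem IsBoundedC0Semigroup.comm (hT : IsBoundedC0Semigroup T) {s t : ℝ} (hs : 0 ≤ s)
    (ht : 0 ≤ t) (x : E) : T s (T t x) = T t (T s x) := by
  rw [← ContinuousLinearMap.comp_apply, ← hT.apply_add s t hs ht, add_comm,
    hT.apply_add t s ht hs, ContinuousLinearMap.comp_apply]

theorem integral_exp_neg_mul_Ioi {l : ℝ} (hl : 0 < l) :
    ∫ r : ℝ in Ioi 0, (Real.exp (-(l * r)) : ℂ) = (l : ℂ)⁻¹ := by
  rw [integral_complex_ofReal]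
  have := integral_exp_mul_Ioi (a := -l) (by linarith) 0
  simp only [neg_mul] at this
  rw [this]
  simp

/-- Near $0$ the difference quotients converge, hence are bounded; away from $0$ boundedness of the
semigroup suffices. -/
theorem IsBoundedC0Semigroup.exists_bound_sub (hT : IsBoundedC0Semigroup T) {x : E}
    (hx : x ∈ (generator T).domain) :
    ∃ C, 0 ≤ C ∧ ∀ r, 0 < r → ‖x - T r x‖ ≤ C * min r 1 := by
  obtain ⟨M, hM0, hM⟩ := hT.exists_bound
  obtain ⟨y, hy⟩ := hx
  have h1 : ∀ᶠ h : ℝ in 𝓝[>] 0, ‖(h : ℂ)⁻¹ • (T h x - x)‖ < ‖y‖ + 1 :=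
    hy.norm.eventually (gt_mem_nhds (by linarith))
  obtain ⟨d, hd, hd'⟩ := mem_nhdsGT_iff_exists_Ioo_subset.1 h1
  have hd : 0 < d := hd
  have hB : ∀ r, 0 < r → ‖x - T r x‖ ≤ (1 + M) * ‖x‖ := fun r hr => by
    refine (norm_sub_le _ _).trans ?_
    rw [add_mul, one_mul]
    exact add_le_add le_rfl (hM r hr.le x)
  -- This covers $d\le r\le1$, where the quotient bound is unavailable but $r$ is bounded below.
  have hK : (1 + M) * ‖x‖ ≤ (1 + M) * ‖x‖ / min d 1 * min d 1 := by
    rw [div_mul_cancel₀]; positivity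
  have hK0 : 0 ≤ (1 + M) * ‖x‖ / min d 1 := by positivity
  refine ⟨(‖y‖ + 1) + (1 + M) * ‖x‖ / min d 1 + (1 + M) * ‖x‖, by positivity, fun r hr => ?_⟩
  rcases le_total 1 r with h | h
  · rw [min_eq_right h, mul_one]
    refine (hB r hr).trans ?_
    have := norm_nonneg y
    linarith
  · rw [min_eq_left h]
    rcases lt_or_ge r d with h' | h'
    · have := hd' ⟨hr, h'⟩
      rw [mem_ofPred_eq, norm_smul, norm_inv, Complex.norm_real, Real.norm_of_nonneg hr.le,
        inv_mul_lt_iff₀ hr, norm_sub_rev] at this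
      refine this.le.trans ?_
      rw [mul_comm, add_assoc]
      exact mul_le_mul_of_nonneg_right (le_add_of_nonneg_right (by positivity)) hr.le
    · refine (hB r hr).trans (hK.trans ?_)
      have : min d 1 ≤ r := (min_le_left _ _).trans h'
      have h5 : 0 ≤ min d 1 := by positivity
      apply mul_le_mul _ this h5 (by positivity)
      have : 0 ≤ (1 + M) * ‖x‖ := by positivity
      have := norm_nonneg y
      linarith

/-- The factor $r$ gained at $0$ leaves $r^{-a}$, integrable as $a<1$; at infinity $a>0$ suffices.
It serves both as dominating function and for Fubini. -/
theorem IsBoundedC0Semigroup.integrableOn_rpow_mul_norm_sub (hT : IsBoundedC0Semigroup T) {x : E}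
    (hx : x ∈ (generator T).domain) {a : ℝ} (h₀ : 0 < a) (h₁ : a < 1) :
    IntegrableOn (fun r : ℝ => r ^ (-a - 1) * ‖x - T r x‖) (Ioi 0) := by
  obtain ⟨C, hC0, hC⟩ := hT.exists_bound_sub hx
  have hcont : ContinuousOn (fun r : ℝ => r ^ (-a - 1) * ‖x - T r x‖) (Ioi 0) := by
    refine ContinuousOn.mul (fun r hr => ?_) ?_
    · exact (Real.continuousAt_rpow_const r _ (Or.inl (ne_of_gt hr))).continuousWithinAt
    · exact (continuousOn_const.sub ((hT.continuousOn x).mono Ioi_subset_Ici_self)).norm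
  have hmeas := hcont.aestronglyMeasurable (μ := volume) measurableSet_Ioi
  rw [← Ioc_union_Ioi_eq_Ioi (zero_le_one (α := ℝ))]
  refine IntegrableOn.union ?_ ?_
  · have hint : IntegrableOn (fun r : ℝ => r ^ (-a) * C) (Ioc 0 1) := by
      refine Integrable.mul_const ?_ _
      have := (intervalIntegral.intervalIntegrable_rpow' (a := 0) (b := 1) (r := -a)
        (by linarith))
      rwa [intervalIntegrable_iff_integrableOn_Ioc_of_le zero_le_one] at this
    refine Integrable.mono' hint (hmeas.mono_measure
      (Measure.restrict_mono Ioc_subset_Ioi_self le_rfl)) ?_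
    refine ae_restrict_of_forall_mem measurableSet_Ioc fun r hr => ?_
    have hr0 : 0 < r := hr.1
    rw [Real.norm_of_nonneg (by positivity)]
    calc r ^ (-a - 1) * ‖x - T r x‖ ≤ r ^ (-a - 1) * (C * r) := by
          gcongr
          exact (hC r hr0).trans (by gcongr; exact min_le_left _ _)
      _ = r ^ (-a) * C := by
          rw [Real.rpow_sub_one hr0.ne']
          field_simp
  · have hint : IntegrableOn (fun r : ℝ => r ^ (-a - 1) * C) (Ioi 1) :=
      Integrable.mul_const (integrableOn_Ioi_rpow_of_lt (by linarith) one_pos) _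
    refine Integrable.mono' hint (hmeas.mono_measure
      (Measure.restrict_mono (Ioi_subset_Ioi zero_le_one) le_rfl)) ?_
    refine ae_restrict_of_forall_mem measurableSet_Ioi fun r hr => ?_
    have hr0 : 0 < r := zero_lt_one.trans hr
    rw [Real.norm_of_nonneg (by positivity)]
    gcongr
    exact (hC r hr0).trans (mul_le_of_le_one_right hC0 (min_le_right _ _))

variable [CompleteSpace E]

theorem IsBoundedC0Semigroup.apply_laplace (hT : IsBoundedC0Semigroup T) {l : ℝ}
    (hl : 0 < l) {s : ℝ} (hs : 0 ≤ s) (x : E) :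
    T s (laplace T l x) = laplace T l (T s x) := by
  rw [laplace, ← ContinuousLinearMap.integral_comp_comm _ (hT.integrableOn_exp_smul hl x), laplace]
  refine setIntegral_congr_fun measurableSet_Ioi fun r hr => ?_
  simp only [map_smul]
  rw [hT.comm hs (le_of_lt hr)]

/-- Translating $r\mapsto r+h$ turns $T(h)$ into a factor $e^{lh}$ and a cut-off at $h$. The
dependence on $h$ is then visibly differentiable at $0$ from the right, for every $x$. -/
theorem IsBoundedC0Semigroup.apply_laplace_eq (hT : IsBoundedC0Semigroup T) {l : ℝ}
    (hl : 0 < l) {h : ℝ} (hh : 0 ≤ h) (x : E) :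
    T h (laplace T l x) = (Real.exp (l * h) : ℂ) •
      (laplace T l x - ∫ r in (0 : ℝ)..h, (Real.exp (-(l * r)) : ℂ) • T r x) := by
  have hint := hT.integrableOn_exp_smul hl x
  have hsplit : laplace T l x = (∫ r in (0 : ℝ)..h, (Real.exp (-(l * r)) : ℂ) • T r x) +
      ∫ r in Ioi h, (Real.exp (-(l * r)) : ℂ) • T r x := by
    rw [laplace, ← Ioc_union_Ioi_eq_Ioi hh, setIntegral_union Ioc_disjoint_Ioi_same
      measurableSet_Ioi (hint.mono_set Ioc_subset_Ioi_self) (hint.mono_set (Ioi_subset_Ioi hh)),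
      intervalIntegral.integral_of_le hh]
  have htrans : ∫ r in Ioi h, (Real.exp (-(l * r)) : ℂ) • T r x =
      ∫ r in Ioi (0 : ℝ), (Real.exp (-(l * (r + h))) : ℂ) • T (r + h) x := by
    have := (measurePreserving_add_right (volume : Measure ℝ) h).setIntegral_preimage_emb
      (measurableEmbedding_addRight h) (fun r => (Real.exp (-(l * r)) : ℂ) • T r x) (Ioi h)
    rw [← this]
    simp
  nth_rewrite 2 [hsplit]
  rw [add_sub_cancel_left, htrans, laplace, ← ContinuousLinearMap.integral_comp_comm _ hint,
    ← integral_smul]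
  refine setIntegral_congr_fun measurableSet_Ioi fun r hr => ?_
  simp only [map_smul]
  rw [smul_smul, ← Complex.ofReal_mul, ← Real.exp_add, add_comm r h,
    hT.apply_add h r hh (le_of_lt hr), ContinuousLinearMap.comp_apply]
  congr 3
  ring_nf

theorem IsBoundedC0Semigroup.tendsto_laplace (hT : IsBoundedC0Semigroup T) {l : ℝ}
    (hl : 0 < l) (x : E) :
    Tendsto (fun h : ℝ => (h : ℂ)⁻¹ • (T h (laplace T l x) - laplace T l x)) (𝓝[>] 0)
      (𝓝 ((l : ℂ) • laplace T l x - x)) := by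
  set y := laplace T l x with hy
  have hc := (hT.continuousOn_exp_smul l x)
  have h1 : HasDerivWithinAt
      (fun h : ℝ => ∫ r in (0 : ℝ)..h, (Real.exp (-(l * r)) : ℂ) • T r x) x (Ici 0) 0 := by
    have := intervalIntegral.integral_hasDerivWithinAt_right
      (f := fun r : ℝ => (Real.exp (-(l * r)) : ℂ) • T r x) (a := 0) (b := 0) (s := Ici 0)
      (t := Ioi 0) (by simp) ?_ ((hc 0 self_mem_Ici).mono Ioi_subset_Ici_self)
    · simpa [hT.apply_zero] using this
    · exact ⟨Ioi 0, self_mem_nhdsWithin,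
        (hc.mono Ioi_subset_Ici_self).aestronglyMeasurable measurableSet_Ioi⟩
  have h2 : HasDerivAt (fun h : ℝ => (Real.exp (l * h) : ℂ)) (l : ℂ) 0 := by
    have := (((hasDerivAt_id (0 : ℝ)).const_mul l).exp).ofReal_comp
    simpa using this
  have h3 := (h2.hasDerivWithinAt (s := Ici 0)).smul ((hasDerivWithinAt_const (0 : ℝ) (Ici 0) y).sub h1)
  have h4 := (hasDerivWithinAt_iff_tendsto_slope' (by simp)).1 (h3.mono Ioi_subset_Ici_self)
  have hlim : (Real.exp (l * 0) : ℂ) • (0 - x) +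
      (l : ℂ) • (y - ∫ r in (0 : ℝ)..0, (Real.exp (-(l * r)) : ℂ) • T r x) =
      (l : ℂ) • y - x := by
    simp [neg_add_eq_sub]
  simp only [Pi.sub_apply] at h4
  rw [hlim] at h4
  refine h4.congr' ?_
  filter_upwards [self_mem_nhdsWithin] with h hh
  rw [slope_def_module, hT.apply_laplace_eq hl (le_of_lt hh), ← Complex.ofReal_inv,
    Complex.coe_smul]
  simp [hy]

/-- Only a right inverse of $l$ minus the generator is produced; since $l+A$ is already known to be
invertible, this determines the resolvent on $D$. -/
theorem IsBoundedC0Semigroup.laplace_mem_generator (hT : IsBoundedC0Semigroup T) {l : ℝ}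
    (hl : 0 < l) (x : E) : ∃ h : laplace T l x ∈ (generator T).domain,
      generator T ⟨laplace T l x, h⟩ = (l : ℂ) • laplace T l x - x := by
  have h : laplace T l x ∈ (generator T).domain := ⟨_, hT.tendsto_laplace hl x⟩
  exact ⟨h, tendsto_nhds_unique h.choose_spec (hT.tendsto_laplace hl x)⟩

end Laplace


/-! ### The derivative of the subordinated family and its limit at zero. -/

section Subordination

/-- The kernel in the definition of `subordination`. -/
def kernel (α : ℂ) (t r : ℝ) : ℂ :=
  (r : ℂ) ^ (-α) * (Real.exp (-(t ^ 2 / (4 * r))) : ℂ) / (r : ℂ)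

theorem kernel_eq (α : ℂ) (t : ℝ) {r : ℝ} (hr : 0 < r) :
    kernel α t r = (r : ℂ) ^ (-α - 1) * (Real.exp (-(t ^ 2 / (4 * r))) : ℂ) := by
  rw [kernel, Complex.cpow_sub _ _ (by exact_mod_cast hr.ne'), Complex.cpow_one]
  ring

variable {E : Type*} [NormedAddCommGroup E] [NormedSpace ℂ E] {T : ℝ → E →L[ℂ] E}

/-- Differentiation under the integral, repeated here because the value of the derivative is needed
and not just its existence. -/
theorem IsBoundedC0Semigroup.hasDerivAt_integral_kernel
    (hT : IsBoundedC0Semigroup T) {α : ℂ} (h₀ : 0 < α.re) {t : ℝ} (ht : 0 < t) (x : E) :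
    IntegrableOn (fun r => (kernel α t r * ((-(t / (2 * r)) : ℝ) : ℂ)) • T r x) (Ioi 0) ∧
    HasDerivAt (fun s => ∫ r : ℝ in Ioi 0, kernel α s r • T r x)
      (∫ r : ℝ in Ioi 0, (kernel α t r * ((-(t / (2 * r)) : ℝ) : ℂ)) • T r x) t := by
  obtain ⟨M, hM0, hM⟩ := hT.exists_bound
  have hder : ∀ r : ℝ, 0 < r → ∀ s : ℝ, HasDerivAt (fun s => kernel α s r • T r x)
      ((kernel α s r * ((-(s / (2 * r)) : ℝ) : ℂ)) • T r x) s := by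
    intro r hr s
    refine HasDerivAt.smul_const ?_ _
    have h1 : HasDerivAt (fun s : ℝ => Real.exp (-(s ^ 2 / (4 * r))))
        (Real.exp (-(s ^ 2 / (4 * r))) * (-(s / (2 * r)))) s := by
      have := (((hasDerivAt_pow 2 s).div_const (4 * r)).neg).exp
      refine this.congr_deriv ?_
      simp only [Pi.neg_apply, Nat.cast_ofNat, Nat.add_one_sub_one, pow_one]
      congr 2
      field_simp; ring
    have h2 := ((h1.ofReal_comp).const_mul ((r : ℂ) ^ (-α))).div_const (r : ℂ)
    refine h2.congr_deriv ?_
    simp only [kernel]; push_cast; ring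
  have hcont : ∀ s : ℝ, ContinuousOn (fun r => kernel α s r • T r x) (Ioi 0) := fun s =>
    (continuousOn_kernel α s).smul ((hT.continuousOn x).mono Ioi_subset_Ici_self)
  refine hasDerivAt_integral_of_dominated_loc_of_deriv_le
    (F := fun s r => kernel α s r • T r x)
    (F' := fun s r => (kernel α s r * ((-(s / (2 * r)) : ℝ) : ℂ)) • T r x)
    -- For $t/2<s<2t$ one has $s^2/4\ge t^2/16$ and $s/(2r)\le t/r$; the latter costs one more power
    -- of $r$.
    (bound := fun r => (r ^ (-(α.re + 1) - 1) * Real.exp (-(t ^ 2 / 16 / r))) * (t * (M * ‖x‖)))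
    (Metric.ball_mem_nhds t (half_pos ht)) ?_ (hT.integrableOn_kernel h₀ ht x) ?_ ?_ ?_ ?_
  · exact Eventually.of_forall fun s => (hcont s).aestronglyMeasurable measurableSet_Ioi
  · refine ContinuousOn.aestronglyMeasurable ?_ measurableSet_Ioi
    refine ((continuousOn_kernel α t).mul ?_).smul
      ((hT.continuousOn x).mono Ioi_subset_Ici_self)
    refine Complex.continuous_ofReal.comp_continuousOn ?_
    refine (continuousOn_const.div (by fun_prop) ?_).neg
    intro r hr
    have : 0 < r := hr
    positivity
  · refine ae_restrict_of_forall_mem measurableSet_Ioi fun r hr s hs => ?_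
    have hr : 0 < r := hr
    rw [Metric.mem_ball, Real.dist_eq, abs_lt] at hs
    have hs1 : t / 2 < s := by linarith
    have hs2 : s < 2 * t := by linarith
    have hs0 : 0 < s := by linarith
    rw [norm_smul, norm_mul, kernel, norm_kernel α s hr, Complex.norm_real, norm_neg,
      Real.norm_of_nonneg (by positivity)]
    have e1 : Real.exp (-(s ^ 2 / 4 / r)) ≤ Real.exp (-(t ^ 2 / 16 / r)) := by
      apply Real.exp_le_exp.2
      apply neg_le_neg
      refine div_le_div_of_nonneg_right ?_ hr.le
      nlinarith
    have e2 : s / (2 * r) ≤ t / r := by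
      rw [div_le_div_iff₀ (by positivity) hr]; nlinarith
    calc r ^ (-α.re - 1) * Real.exp (-(s ^ 2 / 4 / r)) * (s / (2 * r)) * ‖T r x‖
        ≤ r ^ (-α.re - 1) * Real.exp (-(t ^ 2 / 16 / r)) * (t / r) * (M * ‖x‖) := by
          gcongr
          exact hM r hr.le x
      _ = _ := by
          rw [show -(α.re + 1) - 1 = (-α.re - 1) - 1 by ring, Real.rpow_sub_one hr.ne' (-α.re - 1)]
          ring
  · exact (integrableOn_rpow_mul_exp_neg_div (by linarith) (by positivity)).mul_const _
  · exact ae_restrict_of_forall_mem measurableSet_Ioi fun r hr s _ => hder r hr s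

theorem hasDerivAt_ofReal_cpow {r : ℝ} (hr : 0 < r) (b : ℂ) :
    HasDerivAt (fun s : ℝ => (s : ℂ) ^ b) (b * (r : ℂ) ^ (b - 1)) r :=
  (Complex.hasStrictDerivAt_cpow_const (Complex.ofReal_mem_slitPlane.2 hr)).hasDerivAt.comp_ofReal

theorem IsBoundedC0Semigroup.integral_kernel_smul
    (hT : IsBoundedC0Semigroup T) {α : ℂ} (h₀ : 0 < α.re) {t : ℝ} (ht : 0 < t) (x : E) :
    IntegrableOn (fun r => (kernel α t r * (2 * α - ((t ^ 2 / (2 * r) : ℝ) : ℂ))) • T r x)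
      (Ioi 0) ∧
    ∫ r : ℝ in Ioi 0, (kernel α t r * (2 * α - ((t ^ 2 / (2 * r) : ℝ) : ℂ))) • T r x =
      (2 * α) • (∫ r : ℝ in Ioi 0, kernel α t r • T r x) +
      (t : ℂ) • ∫ r : ℝ in Ioi 0, (kernel α t r * ((-(t / (2 * r)) : ℝ) : ℂ)) • T r x := by
  have hint : IntegrableOn (fun r => kernel α t r • T r x) (Ioi 0) :=
    hT.integrableOn_kernel h₀ ht x
  have hint' := (hT.hasDerivAt_integral_kernel h₀ ht x).1
  have hfun : (fun r => (kernel α t r * (2 * α - ((t ^ 2 / (2 * r) : ℝ) : ℂ))) • T r x) =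
      fun r => (2 * α) • (kernel α t r • T r x) +
        (t : ℂ) • ((kernel α t r * ((-(t / (2 * r)) : ℝ) : ℂ)) • T r x) := by
    funext r
    rw [smul_smul, smul_smul, ← add_smul]
    congr 1
    push_cast
    ring
  rw [hfun, ← integral_smul, ← integral_smul]
  exact ⟨(hint.fun_smul (2 * α)).add (hint'.fun_smul (t : ℂ)),
    integral_add (hint.fun_smul (2 * α)) (hint'.fun_smul (t : ℂ))⟩

theorem IsBoundedC0Semigroup.smul_deriv_subordination
    (hT : IsBoundedC0Semigroup T) {α : ℂ} (h₀ : 0 < α.re) {t : ℝ} (ht : 0 < t) (x : E) :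
    (t : ℂ) ^ (1 - 2 * α) • deriv (fun s => subordination T α s x) t =
      (1 / (Complex.Gamma α * 2 ^ (2 * α))) • ∫ r : ℝ in Ioi 0,
        (kernel α t r * (2 * α - ((t ^ 2 / (2 * r) : ℝ) : ℂ))) • T r x := by
  have hloc : (fun s => subordination T α s x) =ᶠ[𝓝 t] fun s : ℝ =>
      (1 / Complex.Gamma α * ((s / 2 : ℝ) : ℂ) ^ (2 * α)) •
        ∫ r : ℝ in Ioi 0, kernel α s r • T r x := by
    filter_upwards [lt_mem_nhds ht] with s hs
    rw [subordination, if_neg hs.ne']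
    rfl
  have htc : (t : ℂ) ≠ 0 := by exact_mod_cast ht.ne'
  have ht2 : ((t / 2 : ℝ) : ℂ) ≠ 0 := by exact_mod_cast (half_pos ht).ne'
  have hpow : HasDerivAt (fun s : ℝ => ((s / 2 : ℝ) : ℂ) ^ (2 * α))
      (2 * α / t * ((t / 2 : ℝ) : ℂ) ^ (2 * α)) t := by
    have h1 := (hasDerivAt_ofReal_cpow (half_pos ht) (2 * α)).scomp t
      ((hasDerivAt_id t).div_const 2)
    refine h1.congr_deriv ?_
    rw [Complex.cpow_sub _ _ ht2, Complex.cpow_one, Complex.real_smul]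
    push_cast
    field_simp
  obtain ⟨hint, hder⟩ := hT.hasDerivAt_integral_kernel h₀ ht x
  have hd := (hpow.const_mul (1 / Complex.Gamma α)).fun_smul hder
  rw [hloc.deriv_eq, hd.deriv]
  -- The weight $t^{1-2\alpha}$ is chosen to cancel the prefactor of $U(t)$ up to one factor $t$,
  -- which clears the $1/t$ from differentiating that prefactor.
  have hscal : (t : ℂ) ^ (1 - 2 * α) * ((t / 2 : ℝ) : ℂ) ^ (2 * α) = t / 2 ^ (2 * α) := by
    have h2 := Complex.div_cpow_ofReal_nonneg ht.le zero_le_two (2 * α)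
    rw [Complex.ofReal_ofNat] at h2
    have h3 : (t : ℂ) ^ (2 * α) ≠ 0 := by simp [Complex.cpow_eq_zero_iff, htc]
    rw [Complex.cpow_sub _ _ htc, Complex.cpow_one, Complex.ofReal_div, Complex.ofReal_ofNat, h2]
    field_simp
  rw [(hT.integral_kernel_smul h₀ ht x).2]
  simp only [smul_add, smul_smul]
  rw [add_comm]
  congr 2
  · calc _ = 1 / Complex.Gamma α * (2 * α / t) *
          ((t : ℂ) ^ (1 - 2 * α) * ((t / 2 : ℝ) : ℂ) ^ (2 * α)) := by ring
      _ = _ := by rw [hscal]; field_simp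
  · calc _ = 1 / Complex.Gamma α *
          ((t : ℂ) ^ (1 - 2 * α) * ((t / 2 : ℝ) : ℂ) ^ (2 * α)) := by ring
      _ = _ := by rw [hscal]; field_simp

theorem tendsto_rpow_mul_exp_neg_div_zero (b : ℝ) {c : ℝ} (hc : 0 < c) :
    Tendsto (fun r : ℝ => r ^ (-b) * Real.exp (-(c / r))) (𝓝[>] 0) (𝓝 0) := by
  have := (tendsto_rpow_mul_exp_neg_mul_atTop_nhds_zero b c hc).comp tendsto_inv_nhdsGT_zero
  refine this.congr' ?_
  filter_upwards [self_mem_nhdsWithin] with r hr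
  have hr : 0 < r := hr
  simp only [Function.comp_apply]
  rw [Real.inv_rpow hr.le, Real.rpow_neg hr.le, div_eq_mul_inv, neg_mul]

/-- The integrand is the derivative of $-2r^{-\alpha}e^{-t^2/(4r)}$, which vanishes at both ends.
Equivalently, $U$ is constant for the trivial semigroup. -/
theorem integral_kernel_mul {α : ℂ} (h₀ : 0 < α.re) {t : ℝ} (ht : 0 < t) :
    IntegrableOn (fun r => kernel α t r * (2 * α - ((t ^ 2 / (2 * r) : ℝ) : ℂ))) (Ioi 0) ∧
    ∫ r : ℝ in Ioi 0, kernel α t r * (2 * α - ((t ^ 2 / (2 * r) : ℝ) : ℂ)) = 0 := by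
  -- Integrability is read off from the vector-valued lemma applied to the identity semigroup on
  -- $\mathbb C$.
  have hid : IsBoundedC0Semigroup (fun _ : ℝ => ContinuousLinearMap.id ℂ ℂ) :=
    ⟨rfl, fun _ _ _ _ => rfl, fun _ => continuousOn_const, ⟨_, fun _ _ => le_rfl⟩⟩
  have hint : IntegrableOn
      (fun r => kernel α t r * (2 * α - ((t ^ 2 / (2 * r) : ℝ) : ℂ))) (Ioi 0) := by
    simpa using (hid.integral_kernel_smul h₀ ht 1).1
  refine ⟨hint, ?_⟩
  set f : ℝ → ℂ := fun r =>
    -2 * ((r : ℂ) ^ (-α) * (Real.exp (-(t ^ 2 / (4 * r))) : ℂ)) with hf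
  have hnorm : ∀ r : ℝ, 0 < r → ‖f r‖ = 2 * (r ^ (-α.re) * Real.exp (-(t ^ 2 / 4 / r))) := by
    intro r hr
    rw [hf]
    simp only
    rw [norm_mul, norm_mul, Complex.norm_cpow_eq_rpow_re_of_pos hr, Complex.norm_real,
      Real.norm_of_nonneg (Real.exp_pos _).le, div_div]
    simp
  have hα : α ≠ 0 := fun h => by simp [h] at h₀
  -- With division by zero the exponential is $1$ here; the value $0$ comes from the convention
  -- $0^{-\alpha}=0$ for $\alpha\ne0$, and agrees with the right limit.
  have hf0 : f 0 = 0 := by simp [hf, hα]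
  have hzero : Tendsto f (𝓝[>] 0) (𝓝 0) := by
    rw [tendsto_zero_iff_norm_tendsto_zero]
    have := (tendsto_rpow_mul_exp_neg_div_zero α.re (c := t ^ 2 / 4) (by positivity)).const_mul 2
    rw [mul_zero] at this
    refine this.congr' ?_
    filter_upwards [self_mem_nhdsWithin] with r hr
    exact (hnorm r hr).symm
  have htop : Tendsto f atTop (𝓝 0) := by
    have := (tendsto_rpow_neg_atTop h₀).const_mul 2
    rw [mul_zero] at this
    refine squeeze_zero_norm' ?_ this
    filter_upwards [eventually_gt_atTop 0] with r hr
    rw [hnorm r hr]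
    gcongr
    refine mul_le_of_le_one_right (by positivity) (Real.exp_le_one_iff.2 ?_)
    have : 0 ≤ t ^ 2 / 4 / r := by positivity
    linarith
  have hder : ∀ r ∈ Ioi (0 : ℝ), HasDerivAt f
      (kernel α t r * (2 * α - ((t ^ 2 / (2 * r) : ℝ) : ℂ))) r := by
    intro r hr
    have hr : 0 < r := hr
    have hrc : (r : ℂ) ≠ 0 := by exact_mod_cast hr.ne'
    have h1 := hasDerivAt_ofReal_cpow hr (-α)
    have h2 : HasDerivAt (fun r : ℝ => Real.exp (-(t ^ 2 / (4 * r))))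
        (Real.exp (-(t ^ 2 / (4 * r))) * (t ^ 2 / (4 * r ^ 2))) r := by
      have := ((((hasDerivAt_id r).const_mul 4).fun_inv (by simpa using hr.ne')).const_mul
        (t ^ 2)).neg.exp
      refine (this.congr_deriv ?_)
      simp only [id, Pi.neg_apply, div_eq_mul_inv, mul_one]
      field_simp
    refine ((h1.mul h2.ofReal_comp).const_mul (-2)).congr_deriv ?_
    rw [kernel_eq α t hr, Complex.cpow_sub _ _ hrc, Complex.cpow_one]
    push_cast
    field_simp
    ring
  have hcw : ContinuousWithinAt f (Ici 0) 0 := by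
    rw [← continuousWithinAt_Ioi_iff_Ici, ContinuousWithinAt, hf0]
    exact hzero
  rw [integral_Ioi_of_hasDerivAt_of_tendsto hcw hder hint htop, hf0, sub_zero]

theorem IsBoundedC0Semigroup.smul_deriv_subordination_eq
    (hT : IsBoundedC0Semigroup T) {α : ℂ} (h₀ : 0 < α.re) {t : ℝ} (ht : 0 < t) (x : E) :
    -((t : ℂ) ^ (1 - 2 * α) • deriv (fun s => subordination T α s x) t) =
      (1 / (Complex.Gamma α * 2 ^ (2 * α))) • ∫ r : ℝ in Ioi 0,
        (kernel α t r * (2 * α - ((t ^ 2 / (2 * r) : ℝ) : ℂ))) • (x - T r x) := by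
  -- In an incomplete space every Bochner integral is $0$ by definition, and both sides vanish.
  by_cases hE : CompleteSpace E
  swap
  · simp [hT.smul_deriv_subordination h₀ ht x, integral, hE]
  obtain ⟨h1, h2⟩ := integral_kernel_mul h₀ ht
  rw [hT.smul_deriv_subordination h₀ ht x, ← smul_neg]
  congr 1
  simp only [smul_sub]
  rw [integral_sub (h1.smul_const x) (hT.integral_kernel_smul h₀ ht x).1, integral_smul_const, h2,
    zero_smul, zero_sub]

/-- With $u=t^2/(4r)$ the weight is controlled by $e^{-u}\le1$ and $ue^{-u}\le1$, uniformly in $t$,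
as dominated convergence requires. -/
theorem norm_kernel_mul_le (α : ℂ) (t : ℝ) {r : ℝ} (hr : 0 < r) :
    ‖kernel α t r * (2 * α - ((t ^ 2 / (2 * r) : ℝ) : ℂ))‖ ≤
      (2 * ‖α‖ + 2) * r ^ (-α.re - 1) := by
  set u := t ^ 2 / 4 / r with hu
  have hu0 : 0 ≤ u := by positivity
  have hu' : t ^ 2 / (2 * r) = 2 * u := by rw [hu]; field_simp; norm_num
  have he : Real.exp (-u) ≤ 1 := Real.exp_le_one_iff.2 (by linarith)
  have he' : u * Real.exp (-u) ≤ 1 := by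
    rw [Real.exp_neg, ← div_eq_mul_inv, div_le_one (Real.exp_pos _)]
    linarith [Real.add_one_le_exp u]
  rw [norm_mul, kernel, norm_kernel α t hr, ← hu, hu', mul_comm (2 * ‖α‖ + 2), mul_assoc]
  gcongr
  have hn : ‖2 * α - ((2 * u : ℝ) : ℂ)‖ ≤ 2 * ‖α‖ + 2 * u := by
    refine (norm_sub_le _ _).trans ?_
    rw [norm_mul, Complex.norm_real, Real.norm_of_nonneg (by positivity)]
    simp
  calc Real.exp (-u) * ‖2 * α - ((2 * u : ℝ) : ℂ)‖
      ≤ Real.exp (-u) * (2 * ‖α‖ + 2 * u) := by gcongr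
    _ = 2 * ‖α‖ * Real.exp (-u) + 2 * (u * Real.exp (-u)) := by ring
    _ ≤ 2 * ‖α‖ * 1 + 2 * 1 := by gcongr
    _ = _ := by ring

theorem IsBoundedC0Semigroup.tendsto_smul_deriv_subordination
    (hT : IsBoundedC0Semigroup T) {α : ℂ} (h₀ : 0 < α.re) (h₁ : α.re < 1) {x : E}
    (hx : x ∈ (generator T).domain) :
    Tendsto (fun t : ℝ => -((t : ℂ) ^ (1 - 2 * α) • deriv (fun s => subordination T α s x) t))
      (𝓝[>] 0) (𝓝 ((2 * α / (Complex.Gamma α * 2 ^ (2 * α))) •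
        ∫ r : ℝ in Ioi 0, (r : ℂ) ^ (-α - 1) • (x - T r x))) := by
  have hlim : Tendsto (fun t : ℝ => ∫ r : ℝ in Ioi 0,
        (kernel α t r * (2 * α - ((t ^ 2 / (2 * r) : ℝ) : ℂ))) • (x - T r x)) (𝓝[>] 0)
      (𝓝 (∫ r : ℝ in Ioi 0, (2 * α) • (r : ℂ) ^ (-α - 1) • (x - T r x))) := by
    refine tendsto_integral_filter_of_dominated_convergence
      (fun r => (2 * ‖α‖ + 2) * (r ^ (-α.re - 1) * ‖x - T r x‖)) ?_ ?_ ?_ ?_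
    · refine Eventually.of_forall fun t => ContinuousOn.aestronglyMeasurable ?_ measurableSet_Ioi
      refine ((continuousOn_kernel α t).mul (continuousOn_const.sub ?_)).smul
        (continuousOn_const.sub ((hT.continuousOn x).mono Ioi_subset_Ici_self))
      refine Complex.continuous_ofReal.comp_continuousOn (continuousOn_const.div (by fun_prop) ?_)
      intro r hr
      have : 0 < r := hr
      positivity
    · refine Eventually.of_forall fun t =>
        ae_restrict_of_forall_mem measurableSet_Ioi fun r hr => ?_
      rw [norm_smul, ← mul_assoc]
      gcongr
      exact norm_kernel_mul_le α t hr
    · exact (hT.integrableOn_rpow_mul_norm_sub hx h₀ h₁).const_mul _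
    · refine ae_restrict_of_forall_mem measurableSet_Ioi fun r hr => ?_
      have hr : 0 < r := hr
      rw [smul_smul]
      refine Tendsto.smul_const ?_ _
      simp only [kernel_eq α _ hr]
      have hc : Continuous fun t : ℝ => (r : ℂ) ^ (-α - 1) *
          (Real.exp (-(t ^ 2 / (4 * r))) : ℂ) * (2 * α - ((t ^ 2 / (2 * r) : ℝ) : ℂ)) := by
        fun_prop
      have := (hc.tendsto 0).mono_left (nhdsWithin_le_nhds (s := Ioi 0))
      simpa [mul_comm] using this
  rw [integral_smul] at hlim
  have hfin := hlim.const_smul (1 / (Complex.Gamma α * 2 ^ (2 * α)))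
  rw [smul_smul, one_div_mul_eq_div] at hfin
  refine hfin.congr' ?_
  filter_upwards [self_mem_nhdsWithin] with t ht
  exact (hT.smul_deriv_subordination_eq h₀ ht x).symm

end Subordination


/-! ### From the resolvent integral to the semigroup integral. -/

section Balakrishnan

variable {E : Type*} [NormedAddCommGroup E] [NormedSpace ℂ E] {T : ℝ → E →L[ℂ] E}

theorem integral_ofReal_cpow_mul_exp {α : ℂ} (h₀ : 0 < α.re) {r : ℝ} (hr : 0 < r) :
    ∫ t : ℝ in Ioi 0, (t : ℂ) ^ α * (Real.exp (-(t * r)) : ℂ) =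
      Complex.Gamma (α + 1) * (r : ℂ) ^ (-α - 1) := by
  have := Complex.integral_cpow_mul_exp_neg_mul_Ioi (a := α + 1) (r := r)
    (by simp; linarith) hr
  rw [add_sub_cancel_right] at this
  rw [one_div, Complex.inv_cpow_ofReal_nonneg hr.le, ← Complex.cpow_neg, neg_add'] at this
  rw [mul_comm, ← this]
  refine setIntegral_congr_fun measurableSet_Ioi fun t _ => ?_
  push_cast
  rw [mul_comm (r : ℂ)]

/-- Since $\int_0^\infty te^{-tr}\,dr=1$, one has $x-t\int_0^\infty e^{-tr}T(r)x\,dr=t\int_0^\infty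
e^{-tr}(x-T(r)x)\,dr$. After Fubini the inner integral in $t$ is a Gamma integral. -/
theorem IsBoundedC0Semigroup.integral_cpow_smul_sub_laplace [CompleteSpace E]
    (hT : IsBoundedC0Semigroup T) {α : ℂ} (h₀ : 0 < α.re) (h₁ : α.re < 1) {x : E}
    (hx : x ∈ (generator T).domain) :
    ∫ t : ℝ in Ioi 0, (t : ℂ) ^ (α - 1) • (x - (t : ℂ) • laplace T t x) =
      Complex.Gamma (α + 1) • ∫ r : ℝ in Ioi 0, (r : ℂ) ^ (-α - 1) • (x - T r x) := by
  set f : ℝ → ℝ → E := fun t r => ((t : ℂ) ^ α * (Real.exp (-(t * r)) : ℂ)) • (x - T r x) with hf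
  have hinner : ∀ t ∈ Ioi (0 : ℝ), (t : ℂ) ^ (α - 1) • (x - (t : ℂ) • laplace T t x) =
      ∫ r in Ioi 0, f t r := by
    intro t ht
    have ht : 0 < t := ht
    have htc : (t : ℂ) ≠ 0 := by exact_mod_cast ht.ne'
    have hexp : IntegrableOn (fun r : ℝ => (Real.exp (-(t * r)) : ℂ)) (Ioi 0) := by
      have := (exp_neg_integrableOn_Ioi 0 ht).ofReal (𝕜 := ℂ)
      simp only [neg_mul] at this
      exact this
    have h1 : ∫ r : ℝ in Ioi 0, (Real.exp (-(t * r)) : ℂ) • (x - T r x) =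
        (t : ℂ)⁻¹ • x - laplace T t x := by
      simp only [smul_sub]
      rw [integral_sub (hexp.smul_const x) (hT.integrableOn_exp_smul ht x),
        integral_smul_const, integral_exp_neg_mul_Ioi ht, laplace]
    simp only [hf, mul_smul]
    rw [integral_smul, h1, Complex.cpow_sub _ _ htc, Complex.cpow_one, smul_sub, smul_sub,
      smul_smul, smul_smul]
    congr 2
    field_simp
  have hTc : ContinuousOn (fun r => x - T r x) (Ioi 0) :=
    continuousOn_const.sub ((hT.continuousOn x).mono Ioi_subset_Ici_self)
  have hfc : ContinuousOn (Function.uncurry f) (Ioi 0 ×ˢ Ioi 0) := by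
    refine ContinuousOn.smul (ContinuousOn.mul ?_ ?_) ?_
    · have : ContinuousOn (fun t : ℝ => (t : ℂ) ^ α) (Ioi 0) := fun t ht =>
        (hasDerivAt_ofReal_cpow ht α).continuousAt.continuousWithinAt
      exact this.comp continuousOn_fst fun p hp => hp.1
    · fun_prop
    · exact hTc.comp continuousOn_snd fun p hp => hp.2
  have hnorm : ∀ r, ∀ t ∈ Ioi (0 : ℝ), ‖f t r‖ =
      t ^ ((α.re + 1) - 1) * Real.exp (-(r * t)) * ‖x - T r x‖ := by
    intro r t ht
    rw [hf]
    simp only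
    rw [norm_smul, norm_mul, Complex.norm_cpow_eq_rpow_re_of_pos ht, Complex.norm_real,
      Real.norm_of_nonneg (Real.exp_pos _).le, add_sub_cancel_right, mul_comm t r]
  -- Integrating the norm in $t$ first leaves
  -- $\Gamma(\operatorname{Re}\alpha+1)\,r^{-\operatorname{Re}\alpha-1}\|x-T(r)x\|$.
  have hfi : Integrable (Function.uncurry f)
      ((volume.restrict (Ioi 0)).prod (volume.restrict (Ioi 0))) := by
    have hmeas : AEStronglyMeasurable (Function.uncurry f)
        ((volume.restrict (Ioi 0)).prod (volume.restrict (Ioi 0))) := by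
      rw [Measure.prod_restrict]
      exact hfc.aestronglyMeasurable (measurableSet_Ioi.prod measurableSet_Ioi)
    rw [integrable_prod_iff' hmeas]
    refine ⟨ae_restrict_of_forall_mem measurableSet_Ioi fun r hr => ?_, ?_⟩
    · have hr : 0 < r := hr
      have hm : AEStronglyMeasurable (fun t => f t r) (volume.restrict (Ioi 0)) :=
        (hfc.comp (f := fun t => (t, r)) (by fun_prop)
          fun t ht => ⟨ht, hr⟩).aestronglyMeasurable measurableSet_Ioi
      have hi := (integrableOn_rpow_mul_exp_neg_mul_rpow (p := 1) (s := α.re) (b := r)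
        (by linarith) one_pos hr).mul_const ‖x - T r x‖
      refine hi.mono' hm (ae_restrict_of_forall_mem measurableSet_Ioi fun t ht => ?_)
      simp only [Function.uncurry]
      rw [hnorm r t ht]
      simp
    · have hi := (hT.integrableOn_rpow_mul_norm_sub hx h₀ h₁).const_mul (Real.Gamma (α.re + 1))
      refine hi.congr (ae_restrict_of_forall_mem measurableSet_Ioi fun r hr => ?_)
      have hr : 0 < r := hr
      simp only [Function.uncurry]
      rw [setIntegral_congr_fun measurableSet_Ioi (hnorm r), integral_mul_const,
        Real.integral_rpow_mul_exp_neg_mul_Ioi (by linarith) hr, one_div,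
        Real.inv_rpow hr.le, ← Real.rpow_neg hr.le, show -(α.re + 1) = -α.re - 1 by ring]
      ring
  rw [setIntegral_congr_fun measurableSet_Ioi hinner, integral_integral_swap hfi, ← integral_smul]
  refine setIntegral_congr_fun measurableSet_Ioi fun r hr => ?_
  simp only [hf]
  rw [integral_smul_const, integral_ofReal_cpow_mul_exp h₀ hr, smul_smul]

end Balakrishnan


/-! ### Resolvents of a non-negative operator. -/

section Resolvent

variable {X : Type*} [NormedAddCommGroup X] [NormedSpace ℂ X] {A : X →ₗ.[ℂ] X}

/-- The bounded operator `(t + A)⁻¹`. -/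
abbrev resolvent (A : X →ₗ.[ℂ] X) (t : ℝ) : X →L[ℂ] X := boundedInverse (shift (t : ℂ) A)

theorem IsNonnegative.resolvent_mem (hA : IsNonnegative A) {t : ℝ} (ht : 0 < t) (y : X) :
    resolvent A t y ∈ A.domain :=
  (hA.isBoundedInverse ht).mem_domain y

theorem IsNonnegative.apply_resolvent (hA : IsNonnegative A) {t : ℝ} (ht : 0 < t) (y : X) :
    A ⟨resolvent A t y, hA.resolvent_mem ht y⟩ = y - (t : ℂ) • resolvent A t y :=
  eq_sub_of_add_eq' ((hA.isBoundedInverse ht).right_inv y)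

theorem IsNonnegative.resolvent_apply (hA : IsNonnegative A) {t : ℝ} (ht : 0 < t) (x : A.domain) :
    resolvent A t (A x) = (x : X) - (t : ℂ) • resolvent A t x :=
  (hA.isBoundedInverse ht).apply_eq x

/-- Exchanging $s$ and $t$ in the resolvent identity only changes its sign, and $s-t$ can be
cancelled. -/
theorem IsNonnegative.resolvent_comm (hA : IsNonnegative A) {s t : ℝ} (hs : 0 < s) (ht : 0 < t)
    (y : X) : resolvent A s (resolvent A t y) = resolvent A t (resolvent A s y) := by
  rcases eq_or_ne s t with rfl | h
  · rfl
  have h1 := (hA.isBoundedInverse hs).sub_eq (hA.isBoundedInverse ht) y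
  have h2 := (hA.isBoundedInverse ht).sub_eq (hA.isBoundedInverse hs) y
  rw [← neg_sub, h1, ← neg_smul, neg_sub] at h2
  have : (s : ℂ) - t ≠ 0 := sub_ne_zero.2 (by exact_mod_cast h)
  exact smul_right_injective X this h2

theorem IsNonnegative.eq_resolvent (hA : IsNonnegative A) {t : ℝ} (ht : 0 < t) {x : X}
    (hx : x ∈ A.domain) {y : X} (h : A ⟨x, hx⟩ = y - (t : ℂ) • x) : x = resolvent A t y := by
  have := hA.resolvent_apply ht ⟨x, hx⟩
  rw [h, map_sub, map_smul] at this
  exact (sub_left_injective this).symm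

theorem IsNonnegative.resolvent_injective (hA : IsNonnegative A) {t : ℝ} (ht : 0 < t) {y : X}
    (h : resolvent A t y = 0) : y = 0 := by
  have h1 := hA.apply_resolvent ht y
  have h2 : A ⟨resolvent A t y, hA.resolvent_mem ht y⟩ = A 0 := by
    congr 1
    exact Subtype.ext h
  rw [h2, A.map_zero, h, smul_zero, sub_zero] at h1
  exact h1.symm

/-- On $\mathcal D(A)$ the error is $(t+A)^{-1}Ax=O(1/t)$; the uniform bound on $t(t+A)^{-1}$
extends convergence to the closure. -/
theorem IsNonnegative.tendsto_smul_resolvent (hA : IsNonnegative A) {x : X}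
    (hx : x ∈ A.domain.topologicalClosure) :
    Tendsto (fun t : ℝ => (t : ℂ) • resolvent A t x) atTop (𝓝 x) := by
  obtain ⟨M, hM0, hM⟩ := hA.exists_bound
  have hdom : ∀ z : A.domain, Tendsto (fun t : ℝ => (t : ℂ) • resolvent A t z) atTop
      (𝓝 (z : X)) := by
    intro z
    rw [tendsto_iff_norm_sub_tendsto_zero]
    have h0 : Tendsto (fun t : ℝ => M * ‖A z‖ / t) atTop (𝓝 0) :=
      tendsto_const_nhds.div_atTop tendsto_id
    refine squeeze_zero' (Eventually.of_forall fun _ => norm_nonneg _) ?_ h0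
    filter_upwards [eventually_gt_atTop 0] with t ht
    rw [← norm_neg, neg_sub, ← hA.resolvent_apply ht z]
    refine (hM t ht _).trans (le_of_eq ?_)
    ring
  have hbound : ∀ t : ℝ, 0 < t → ∀ y, ‖(t : ℂ) • resolvent A t y‖ ≤ M * ‖y‖ := by
    intro t ht y
    rw [norm_smul, Complex.norm_real, Real.norm_of_nonneg ht.le]
    calc t * ‖resolvent A t y‖ ≤ t * (M / t * ‖y‖) := by gcongr; exact hM t ht y
      _ = M * ‖y‖ := by field_simp
  rw [Metric.tendsto_nhds]
  intro ε hε
  have hx' : x ∈ closure (A.domain : Set X) := hx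
  obtain ⟨z, hz, hxz⟩ := Metric.mem_closure_iff.1 hx' (ε / (2 * (M + 1))) (by positivity)
  have h1 := (Metric.tendsto_nhds.1 (hdom ⟨z, hz⟩)) (ε / 2) (half_pos hε)
  filter_upwards [h1, eventually_gt_atTop 0] with t ht ht0
  rw [dist_eq_norm] at ht hxz ⊢
  have e : (t : ℂ) • resolvent A t x - x = (t : ℂ) • resolvent A t (x - z) +
      ((t : ℂ) • resolvent A t z - z) + (z - x) := by
    rw [map_sub, smul_sub]; abel
  have h2 : (M + 1) * ‖x - z‖ < ε / 2 := by
    have := mul_lt_mul_of_pos_left hxz (show 0 < M + 1 by linarith)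
    refine this.trans_eq ?_
    field_simp
  calc ‖(t : ℂ) • resolvent A t x - x‖
      ≤ ‖(t : ℂ) • resolvent A t (x - z)‖ + ‖(t : ℂ) • resolvent A t z - z‖ + ‖z - x‖ := by
        rw [e]; exact norm_add₃_le
    _ ≤ M * ‖x - z‖ + ‖(t : ℂ) • resolvent A t z - z‖ + ‖x - z‖ := by
        rw [norm_sub_rev z x]; gcongr; exact hbound t ht0 _
    _ < ε := by
        linarith

end Resolvent

/-! ### Closability of the Balakrishnan operator. -/

section BalakrishnanOperator

variable {X : Type*} [NormedAddCommGroup X] [NormedSpace ℂ X] {A : X →ₗ.[ℂ] X}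

/-- The integral `sin(α π) / π * ∫_0^∞ t^(α - 1) (x - t (t + A)⁻¹ x) dt`, which gives the values
of `balakrishnan` on `𝒟(A)`. -/
def balakrishnanIntegral (A : X →ₗ.[ℂ] X) (α : ℂ) (x : X) : X :=
  (Complex.sin (α * Real.pi) / Real.pi) •
    ∫ t : ℝ in Ioi 0, (t : ℂ) ^ (α - 1) • (x - (t : ℂ) • resolvent A t x)

theorem IsNonnegative.integrableOn_cpow_smul_sub_resolvent (hA : IsNonnegative A) {α : ℂ}
    (h₀ : 0 < α.re) (h₁ : α.re < 1) {x : X} (hx : x ∈ A.domain) :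
    IntegrableOn (fun t : ℝ => (t : ℂ) ^ (α - 1) • (x - (t : ℂ) • resolvent A t x)) (Ioi 0) := by
  refine (hA.integrableOn_balakrishnan h₀ h₁ ⟨x, hx⟩).congr_fun (fun t ht => ?_) measurableSet_Ioi
  beta_reduce
  rw [hA.resolvent_apply ht ⟨x, hx⟩]

theorem balakrishnan_apply (hA : IsNonnegative A) {α : ℂ} (h₀ : 0 < α.re) (h₁ : α.re < 1)
    (x : A.domain) : balakrishnan A hA α h₀ h₁ x = balakrishnanIntegral A α x := by
  have h : balakrishnan A hA α h₀ h₁ x = (Complex.sin (α * Real.pi) / Real.pi) •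
      ∫ t : ℝ in Ioi 0, (t : ℂ) ^ (α - 1) • resolvent A t (A x) := rfl
  rw [h, balakrishnanIntegral]
  congr 1
  refine setIntegral_congr_fun measurableSet_Ioi fun t ht => ?_
  rw [hA.resolvent_apply ht x]

theorem mem_graph_balakrishnan (hA : IsNonnegative A) {α : ℂ} (h₀ : 0 < α.re) (h₁ : α.re < 1)
    {p : X × X} : p ∈ (balakrishnan A hA α h₀ h₁).graph ↔
      p.1 ∈ A.domain ∧ balakrishnanIntegral A α p.1 = p.2 := by
  rw [LinearPMap.mem_graph_iff]
  constructor
  · rintro ⟨x, hx1, hx2⟩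
    rw [← hx1]
    exact ⟨x.2, (balakrishnan_apply hA h₀ h₁ x).symm.trans hx2⟩
  · rintro ⟨h1, h2⟩
    exact ⟨⟨p.1, h1⟩, rfl, (balakrishnan_apply hA h₀ h₁ ⟨p.1, h1⟩).trans h2⟩

theorem IsNonnegative.resolvent_balakrishnanIntegral [CompleteSpace X] (hA : IsNonnegative A) {α : ℂ}
    (h₀ : 0 < α.re) (h₁ : α.re < 1) {s : ℝ} (hs : 0 < s) {x : X} (hx : x ∈ A.domain) :
    resolvent A s (balakrishnanIntegral A α x) = balakrishnanIntegral A α (resolvent A s x) := by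
  rw [balakrishnanIntegral, balakrishnanIntegral, map_smul,
    ← ContinuousLinearMap.integral_comp_comm _
      (hA.integrableOn_cpow_smul_sub_resolvent h₀ h₁ hx)]
  congr 1
  refine setIntegral_congr_fun measurableSet_Ioi fun t ht => ?_
  rw [map_smul, map_sub, map_smul, hA.resolvent_comm hs ht]

theorem integrableOn_rpow_mul_min {a : ℝ} (h₀ : 0 < a) (h₁ : a < 1) :
    IntegrableOn (fun t : ℝ => t ^ (a - 1) * min 1 (1 / t)) (Ioi 0) := by
  have hcont : ContinuousOn (fun t : ℝ => t ^ (a - 1) * min 1 (1 / t)) (Ioi 0) := by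
    refine ContinuousOn.mul (fun t ht => ?_) (fun t ht => ?_)
    · exact (Real.continuousAt_rpow_const t _ (Or.inl (ne_of_gt ht))).continuousWithinAt
    · have : t ≠ 0 := ne_of_gt ht
      exact ContinuousAt.continuousWithinAt (by fun_prop (disch := assumption))
  have hmeas := hcont.aestronglyMeasurable (μ := volume) measurableSet_Ioi
  rw [← Ioc_union_Ioi_eq_Ioi (zero_le_one (α := ℝ))]
  refine IntegrableOn.union ?_ ?_
  · have hint := intervalIntegral.intervalIntegrable_rpow' (a := 0) (b := 1) (r := a - 1)
      (by linarith)
    rw [intervalIntegrable_iff_integrableOn_Ioc_of_le zero_le_one] at hint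
    refine Integrable.mono' hint (hmeas.mono_measure
      (Measure.restrict_mono Ioc_subset_Ioi_self le_rfl)) ?_
    refine ae_restrict_of_forall_mem measurableSet_Ioc fun t ht => ?_
    have ht0 : 0 < t := ht.1
    rw [Real.norm_of_nonneg (by positivity)]
    exact mul_le_of_le_one_right (by positivity) (min_le_left _ _)
  · have hint : IntegrableOn (fun t : ℝ => t ^ (a - 1 - 1)) (Ioi 1) :=
      integrableOn_Ioi_rpow_of_lt (by linarith) one_pos
    refine Integrable.mono' hint (hmeas.mono_measure
      (Measure.restrict_mono (Ioi_subset_Ioi zero_le_one) le_rfl)) ?_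
    refine ae_restrict_of_forall_mem measurableSet_Ioi fun t ht => ?_
    have ht0 : 0 < t := zero_lt_one.trans ht
    rw [Real.norm_of_nonneg (by positivity), Real.rpow_sub_one ht0.ne' (a - 1), div_eq_mul_one_div (t ^ (a - 1))]
    gcongr
    exact min_le_right _ _

/-- For $x=R_1y$ the quantity $x-tR_tx$ is bounded, and it equals $R_tAR_1y=R_t(y-R_1y)=O(1/t)$.
Both bounds are linear in $\|y\|$ and together dominate the integral. -/
theorem IsNonnegative.exists_continuousLinearMap_balakrishnanIntegral (hA : IsNonnegative A)
    {α : ℂ} (h₀ : 0 < α.re) (h₁ : α.re < 1) :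
    ∃ B : X →L[ℂ] X, ∀ y, B y = balakrishnanIntegral A α (resolvent A 1 y) := by
  obtain ⟨M, hM0, hM⟩ := hA.exists_bound
  have hR1 : ∀ y, ‖resolvent A 1 y‖ ≤ M * ‖y‖ := fun y => by
    have := hM 1 one_pos y
    rwa [div_one] at this
  have hmem := hA.resolvent_mem one_pos
  have hint := fun y => hA.integrableOn_cpow_smul_sub_resolvent h₀ h₁ (hmem y)
  -- One factor $1+M$ bounds $1-tR_t$ or $tR_t$, the other $R_1$ or $1-R_1$.
  set K : ℝ := (1 + M) * (1 + M) with hK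
  have hbound : ∀ y : X, ∀ t : ℝ, 0 < t →
      ‖resolvent A 1 y - (t : ℂ) • resolvent A t (resolvent A 1 y)‖ ≤
        min 1 (1 / t) * (K * ‖y‖) := by
    intro y t ht
    rw [min_mul_of_nonneg _ _ (by positivity), one_mul]
    refine le_min ?_ ?_
    · refine (norm_sub_le _ _).trans ?_
      rw [norm_smul, Complex.norm_real, Real.norm_of_nonneg ht.le]
      calc ‖resolvent A 1 y‖ + t * ‖resolvent A t (resolvent A 1 y)‖
          ≤ ‖resolvent A 1 y‖ + t * (M / t * ‖resolvent A 1 y‖) := by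
            gcongr; exact hM t ht _
        _ = (1 + M) * ‖resolvent A 1 y‖ := by field_simp
        _ ≤ (1 + M) * ((1 + M) * ‖y‖) := by
            gcongr
            exact (hR1 y).trans (by gcongr; linarith)
        _ = K * ‖y‖ := by rw [hK]; ring
    · rw [← hA.resolvent_apply ht ⟨_, hmem y⟩, hA.apply_resolvent one_pos]
      refine (hM t ht _).trans ?_
      calc M / t * ‖y - ((1 : ℝ) : ℂ) • resolvent A 1 y‖ ≤ (1 + M) / t * (‖y‖ + M * ‖y‖) := by
            gcongr
            · linarith
            · refine (norm_sub_le _ _).trans ?_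
              rw [norm_smul, Complex.norm_real, norm_one, one_mul]
              gcongr
              exact hR1 y
        _ = 1 / t * (K * ‖y‖) := by rw [hK]; ring
  set c : ℂ := Complex.sin (α * Real.pi) / Real.pi with hc
  let L : X →ₗ[ℂ] X :=
    { toFun := fun y => balakrishnanIntegral A α (resolvent A 1 y)
      map_add' := fun y z => by
        rw [balakrishnanIntegral, balakrishnanIntegral, balakrishnanIntegral, ← smul_add,
          ← integral_add (hint y) (hint z)]
        congr 2
        funext t
        simp only [map_add, smul_add, smul_sub]
        abel
      map_smul' := fun k y => by
        rw [RingHom.id_apply, balakrishnanIntegral, balakrishnanIntegral, smul_comm k,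
          ← integral_smul k]
        congr 2
        funext t
        simp only [map_smul]
        rw [smul_comm k ((t : ℂ) ^ (α - 1)), smul_sub k, smul_comm k (t : ℂ)] }
  refine ⟨L.mkContinuous (‖c‖ * ((∫ t in Ioi (0 : ℝ), t ^ (α.re - 1) * min 1 (1 / t)) * K))
    fun y => ?_, fun y => rfl⟩
  change ‖balakrishnanIntegral A α (resolvent A 1 y)‖ ≤ _
  rw [balakrishnanIntegral, ← hc, norm_smul, mul_assoc, mul_assoc]
  gcongr
  rw [← integral_mul_const]
  refine norm_integral_le_of_norm_le
    ((integrableOn_rpow_mul_min h₀ h₁).mul_const (K * ‖y‖))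
    (ae_restrict_of_forall_mem measurableSet_Ioi fun t ht => ?_)
  rw [norm_smul, Complex.norm_cpow_eq_rpow_re_of_pos ht, mul_assoc]
  simp only [Complex.sub_re, Complex.one_re]
  have : 0 < t := ht
  gcongr
  exact hbound y t ht

/-- The relation $J^\alpha_AR_1x=R_1y$ holds on the graph and is closed, because $J^\alpha_AR_1$ is
bounded. At $x=0$ it forces $R_1y=0$, hence $y=0$. -/
theorem isClosable_balakrishnan [CompleteSpace X] (hA : IsNonnegative A) {α : ℂ} (h₀ : 0 < α.re)
    (h₁ : α.re < 1) : (balakrishnan A hA α h₀ h₁).IsClosable := by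
  set J := balakrishnan A hA α h₀ h₁ with hJ
  obtain ⟨B, hB⟩ := hA.exists_continuousLinearMap_balakrishnanIntegral h₀ h₁
  have key : ∀ p ∈ J.graph.topologicalClosure, B p.1 = resolvent A 1 p.2 := by
    intro p hp
    have hcl : IsClosed {p : X × X | B p.1 = resolvent A 1 p.2} :=
      isClosed_eq (by fun_prop) (by fun_prop)
    refine closure_minimal ?_ hcl hp
    intro q hq
    obtain ⟨hx1, hx2⟩ := (mem_graph_balakrishnan hA h₀ h₁).1 hq
    rw [mem_ofPred_eq, ← hx2, hB, hA.resolvent_balakrishnanIntegral h₀ h₁ one_pos hx1]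
  refine ⟨J.graph.topologicalClosure.toLinearPMap, (Submodule.toLinearPMap_graph_eq _ ?_).symm⟩
  intro p hp h0
  have := key p hp
  rw [h0, map_zero] at this
  exact hA.resolvent_injective one_pos this.symm

end BalakrishnanOperator


/-! ### Operators commuting with the semigroup. -/

section Commutation

variable {E : Type*} [NormedAddCommGroup E] [NormedSpace ℂ E] {T : ℝ → E →L[ℂ] E}

theorem IsBoundedC0Semigroup.subordination_comm [CompleteSpace E] (hT : IsBoundedC0Semigroup T)
    {α : ℂ} (h₀ : 0 < α.re) {S : E →L[ℂ] E} (hS : ∀ r, 0 < r → ∀ x, T r (S x) = S (T r x)) {t : ℝ}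
    (ht : 0 < t) (x : E) : subordination T α t (S x) = S (subordination T α t x) := by
  simp only [subordination, if_neg ht.ne']
  rw [map_smul, ← ContinuousLinearMap.integral_comp_comm _ (hT.integrableOn_kernel h₀ ht x)]
  congr 1
  refine setIntegral_congr_fun measurableSet_Ioi fun r hr => ?_
  simp only [map_smul]
  rw [hS r hr]

theorem IsBoundedC0Semigroup.deriv_subordination_comm [CompleteSpace E]
    (hT : IsBoundedC0Semigroup T) {α : ℂ} (h₀ : 0 < α.re) {S : E →L[ℂ] E}
    (hS : ∀ r, 0 < r → ∀ x, T r (S x) = S (T r x)) {t : ℝ} (ht : 0 < t) (x : E) :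
    deriv (fun s => subordination T α s (S x)) t =
      S (deriv (fun s => subordination T α s x) t) := by
  have h := ((S.restrictScalars ℝ).hasFDerivAt.comp_hasDerivAt t
    (hT.differentiableAt_subordination h₀ ht x).hasDerivAt)
  refine (EventuallyEq.deriv_eq ?_).trans h.deriv
  filter_upwards [lt_mem_nhds ht] with s hs
  exact hT.subordination_comm h₀ hS hs x

end Commutation

/-! ### Comparison on the domain of the part of $A$ in $D$. -/

section Part

variable {X : Type*} [NormedAddCommGroup X] [NormedSpace ℂ X] {A : X →ₗ.[ℂ] X}
  {D : Submodule ℂ X} {T : ℝ → D →L[ℂ] D}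

theorem resolvent_eq_laplace (hA : IsNonnegative A) [CompleteSpace D] (hT : IsBoundedC0Semigroup T)
    (hgen : generator T = -part A D) {t : ℝ} (ht : 0 < t) (x : D) :
    resolvent A t (x : X) = laplace T t x := by
  -- The operator is generalised so that the equation for the generator can be substituted inside
  -- the dependent domain membership.
  have key : ∀ B : D →ₗ.[ℂ] D, generator T = B → ∃ h : laplace T t x ∈ B.domain,
      B ⟨laplace T t x, h⟩ = (t : ℂ) • laplace T t x - x := by
    rintro _ rfl
    exact hT.laplace_mem_generator ht x
  obtain ⟨h, hx⟩ := key _ hgen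
  rw [LinearPMap.neg_apply, neg_eq_iff_eq_neg, neg_sub] at hx
  exact (hA.eq_resolvent ht (x := ((laplace T t x : D) : X)) h.1 (congrArg Subtype.val hx)).symm

theorem resolvent_mem_part (hA : IsNonnegative A) (hAD : A.domain ≤ D) {t : ℝ} (ht : 0 < t)
    (x : D) : ∃ h : resolvent A t (x : X) ∈ D, (⟨_, h⟩ : D) ∈ (part A D).domain := by
  refine ⟨hAD (hA.resolvent_mem ht _), hA.resolvent_mem ht _, ?_⟩
  rw [hA.apply_resolvent ht]
  exact D.sub_mem x.2 (D.smul_mem _ (hAD (hA.resolvent_mem ht _)))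

/-- The isometric inclusion of $D$ commutes with the integral. In particular $J^\alpha_A$ takes
values in $D$ on $\mathcal D(A)\subseteq D$. -/
theorem balakrishnanIntegral_coe [CompleteSpace X] (hA : IsNonnegative A) [CompleteSpace D]
    (hT : IsBoundedC0Semigroup T) (hgen : generator T = -part A D) (α : ℂ) (x : D) :
    balakrishnanIntegral A α (x : X) = ((Complex.sin (α * Real.pi) / Real.pi) •
      ∫ t : ℝ in Ioi 0, (t : ℂ) ^ (α - 1) • (x - (t : ℂ) • laplace T t x) : D) := by
  rw [balakrishnanIntegral, Submodule.coe_smul]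
  congr 1
  have := D.subtypeₗᵢ.integral_comp_comm
    (μ := volume.restrict (Ioi (0 : ℝ)))
    (fun t : ℝ => (t : ℂ) ^ (α - 1) • (x - (t : ℂ) • laplace T t x))
  refine Eq.trans (setIntegral_congr_fun measurableSet_Ioi fun t ht => ?_) this
  rw [resolvent_eq_laplace hA hT hgen ht]
  rfl

/-- Combines $\Gamma(\alpha)\Gamma(1-\alpha)=\pi/\sin(\pi\alpha)$ with
$\Gamma(\alpha+1)=\alpha\Gamma(\alpha)$; this is where $c_\alpha$ gets its value. -/
theorem gamma_quotient_mul_sin {α : ℂ} (h₀ : 0 < α.re) (h₁ : α.re < 1) :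
    Complex.Gamma (1 - α) / ((2 : ℂ) ^ (2 * α - 1) * Complex.Gamma α) *
      (Complex.sin (α * Real.pi) / Real.pi * Complex.Gamma (α + 1)) =
      2 * α / (Complex.Gamma α * 2 ^ (2 * α)) := by
  have hα : α ≠ 0 := fun h => by simp [h] at h₀
  have hg : Complex.Gamma α ≠ 0 := Complex.Gamma_ne_zero_of_re_pos h₀
  have hg1 : Complex.Gamma (1 - α) ≠ 0 := Complex.Gamma_ne_zero_of_re_pos (by simp; linarith)
  have hpi : (Real.pi : ℂ) ≠ 0 := by exact_mod_cast Real.pi_ne_zero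
  have hrefl := Complex.Gamma_mul_Gamma_one_sub α
  have hsin : Complex.sin (Real.pi * α) ≠ 0 := by
    intro h
    rw [h, div_zero] at hrefl
    exact mul_ne_zero hg hg1 hrefl
  have h2 : (2 : ℂ) ^ (2 * α) ≠ 0 := by simp [Complex.cpow_eq_zero_iff]
  rw [Complex.Gamma_add_one _ hα, Complex.cpow_sub _ _ two_ne_zero, Complex.cpow_one,
    mul_comm α (Real.pi : ℂ)]
  rw [eq_div_iff hsin] at hrefl
  generalize Complex.sin (Real.pi * α) = S at hrefl ⊢
  field_simp
  linear_combination hrefl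

theorem tendsto_neumannData [CompleteSpace X] (hA : IsNonnegative A) [CompleteSpace D]
    (hT : IsBoundedC0Semigroup T) (hgen : generator T = -part A D) {α : ℂ} (h₀ : 0 < α.re)
    (h₁ : α.re < 1) {x : D} (hx : x ∈ (part A D).domain) :
    Tendsto (neumannData T α x) (𝓝[>] 0)
      (𝓝 ((Complex.Gamma (1 - α) / ((2 : ℂ) ^ (2 * α - 1) * Complex.Gamma α)) •
        balakrishnanIntegral A α (x : X))) := by
  have hx' : x ∈ (generator T).domain := by rw [hgen]; exact hx
  have h := hT.tendsto_smul_deriv_subordination h₀ h₁ hx'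
  rw [balakrishnanIntegral_coe hA hT hgen, hT.integral_cpow_smul_sub_laplace h₀ h₁ hx',
    ← Submodule.coe_smul, smul_smul, smul_smul, mul_assoc, gamma_quotient_mul_sin h₀ h₁]
  exact (continuous_subtype_val.tendsto _).comp h

/-- On $D$ the resolvent is a Laplace transform of the semigroup, so it commutes with every $T(r)$,
hence with $U(t)$ and its derivative. -/
theorem neumannData_resolvent (hA : IsNonnegative A) (hAD : A.domain ≤ D) [CompleteSpace D]
    (hT : IsBoundedC0Semigroup T) (hgen : generator T = -part A D) {α : ℂ} (h₀ : 0 < α.re)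
    {s : ℝ} (hs : 0 < s) (x : D) {t : ℝ} (ht : 0 < t) :
    neumannData T α ⟨resolvent A s (x : X), hAD (hA.resolvent_mem hs _)⟩ t =
      resolvent A s (neumannData T α x t) := by
  let S : D →L[ℂ] D := ((resolvent A s).comp D.subtypeL).codRestrict D
    fun y => hAD (hA.resolvent_mem hs _)
  have hSl : ∀ y, S y = laplace T s y := fun y =>
    Subtype.ext (resolvent_eq_laplace hA hT hgen hs y)
  have hS : ∀ r, 0 < r → ∀ y, T r (S y) = S (T r y) := fun r hr y => by
    rw [hSl, hSl, hT.apply_laplace hs hr.le]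
  have h := hT.deriv_subordination_comm h₀ hS ht x
  have e : (⟨resolvent A s (x : X), hAD (hA.resolvent_mem hs _)⟩ : D) = S x := rfl
  rw [e, neumannData, neumannData, h, map_neg, map_smul]
  rfl

theorem mem_graph_dirichletToNeumann (hT : IsBoundedC0Semigroup T) {α : ℂ}
    (h₀ : 0 < α.re) {p : X × X} : p ∈ (dirichletToNeumann T hT α h₀).graph ↔
      ∃ h : p.1 ∈ D, Tendsto (neumannData T α ⟨p.1, h⟩) (𝓝[>] 0) (𝓝 p.2) := by
  rw [LinearPMap.mem_graph_iff]
  constructor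
  · rintro ⟨⟨x, hx⟩, rfl, hx2⟩
    have := hx.choose_spec.choose_spec
    rw [← hx2]
    exact ⟨hx.choose, this⟩
  · rintro ⟨h, hp⟩
    have hx : ∃ h : p.1 ∈ D, ∃ y : X,
        Tendsto (neumannData T α ⟨p.1, h⟩) (𝓝[>] 0) (𝓝 y) := ⟨h, p.2, hp⟩
    exact ⟨⟨p.1, hx⟩, rfl, tendsto_nhds_unique hx.choose_spec.choose_spec hp⟩

end Part

end FracPow

end

/-! ### Comparison of the closures. -/

theorem theorem3p9 {X : Type*} [NormedAddCommGroup X] [NormedSpace ℂ X] [CompleteSpace X]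
    (A : X →ₗ.[ℂ] X) (hA : FracPow.IsNonnegative A)
    (D : Submodule ℂ X) (hD : D = A.domain.topologicalClosure)
    (T : ℝ → D →L[ℂ] D) (hT : FracPow.IsBoundedC0Semigroup T)
    (hgen : FracPow.generator T = -FracPow.part A D)
    (α : ℂ) (h₀ : 0 < α.re) (h₁ : α.re < 1)
    (c : ℂ)
    (hc : c = Complex.Gamma (1 - α) / ((2 : ℂ) ^ (2 * α - 1) * Complex.Gamma α)) :
    (FracPow.balakrishnan A hA α h₀ h₁).IsClosable ∧
    (FracPow.dirichletToNeumann T hT α h₀).IsClosable ∧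
    (FracPow.dirichletToNeumann T hT α h₀).closure =
      c • (FracPow.balakrishnan A hA α h₀ h₁).closure := by
  have hAD : A.domain ≤ D := hD ▸ A.domain.le_topologicalClosure
  have hDcl : IsClosed (D : Set X) := hD ▸ A.domain.isClosed_topologicalClosure
  have : CompleteSpace D := hDcl.completeSpace_coe
  have hc0 : c ≠ 0 := by
    rw [hc]
    refine div_ne_zero (Complex.Gamma_ne_zero_of_re_pos (by simp; linarith))
      (mul_ne_zero ?_ (Complex.Gamma_ne_zero_of_re_pos h₀))
    simp [Complex.cpow_eq_zero_iff]
  have hJ := FracPow.isClosable_balakrishnan hA h₀ h₁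
  set J := FracPow.balakrishnan A hA α h₀ h₁ with hJdef
  set N := FracPow.dirichletToNeumann T hT α h₀ with hN
  have hreg : ∀ {x : X}, x ∈ D →
      Tendsto (fun s : ℝ => (s : ℂ) • FracPow.resolvent A s x) atTop (𝓝 x) := fun hx =>
    hA.tendsto_smul_resolvent (hD ▸ hx)
  have hcore : ∀ p : X × X, p ∈ J.graph → (p.1, c • p.2) ∈ N.graph.topologicalClosure := by
    intro p hp
    obtain ⟨hp1, hp2⟩ := (FracPow.mem_graph_balakrishnan hA h₀ h₁).1 hp
    have hp2D : p.2 ∈ D := by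
      rw [← hp2, FracPow.balakrishnanIntegral_coe hA hT hgen α ⟨p.1, hAD hp1⟩]
      exact Subtype.coe_prop _
    -- The approximants are $s(R_sx,\,cR_sy)$ with $s\to\infty$. Both $x$ and $y$ must lie in $D$
    -- for them to converge to $(x,cy)$.
    refine mem_closure_of_tendsto
      ((hreg (hAD hp1)).prodMk_nhds ((hreg hp2D).const_smul c)) ?_
    filter_upwards [eventually_gt_atTop 0] with s hs
    rw [smul_comm c]
    refine N.graph.smul_mem (s : ℂ) (x := (FracPow.resolvent A s p.1,
      c • FracPow.resolvent A s p.2)) ?_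
    obtain ⟨h, hmem⟩ := FracPow.resolvent_mem_part hA hAD hs ⟨p.1, hAD hp1⟩
    refine (FracPow.mem_graph_dirichletToNeumann hT h₀).2 ⟨h, ?_⟩
    have := FracPow.tendsto_neumannData hA hT hgen h₀ h₁ hmem
    rw [← hc] at this
    rw [← hp2, hA.resolvent_balakrishnanIntegral h₀ h₁ hs hp1]
    exact this
  have hcore' : ∀ p : X × X, p ∈ N.graph → (p.1, c⁻¹ • p.2) ∈ J.graph.topologicalClosure := by
    intro p hp
    obtain ⟨hp1, hp2⟩ := (FracPow.mem_graph_dirichletToNeumann hT h₀).1 hp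
    -- The limit is taken in $X$, but the Neumann data lie in the closed subspace $D$.
    have hp2D : p.2 ∈ D := hDcl.mem_of_tendsto hp2
      (Eventually.of_forall fun t => D.neg_mem (D.smul_mem _ (Subtype.coe_prop _)))
    refine mem_closure_of_tendsto
      ((hreg hp1).prodMk_nhds ((hreg hp2D).const_smul c⁻¹)) ?_
    filter_upwards [eventually_gt_atTop 0] with s hs
    rw [smul_comm c⁻¹]
    refine J.graph.smul_mem (s : ℂ) (x := (FracPow.resolvent A s p.1,
      c⁻¹ • FracPow.resolvent A s p.2)) ?_
    refine (FracPow.mem_graph_balakrishnan hA h₀ h₁).2 ⟨hA.resolvent_mem hs _, ?_⟩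
    obtain ⟨h, hmem⟩ := FracPow.resolvent_mem_part hA hAD hs ⟨p.1, hp1⟩
    have h1 := FracPow.tendsto_neumannData hA hT hgen h₀ h₁ hmem
    rw [← hc] at h1
    have h2 : Tendsto (FracPow.neumannData T α ⟨FracPow.resolvent A s p.1, h⟩) (𝓝[>] 0)
        (𝓝 (FracPow.resolvent A s p.2)) := by
      refine (((FracPow.resolvent A s).continuous.tendsto _).comp hp2).congr' ?_
      filter_upwards [self_mem_nhdsWithin] with t ht
      exact (FracPow.neumannData_resolvent hA hAD hT hgen h₀ hs ⟨p.1, hp1⟩ ht).symm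
    rw [eq_inv_smul_iff₀ hc0]
    -- The Neumann data of $R_sx$ tend to $cJ^\alpha_AR_sx$ because $R_sx\in\mathcal D(A_D)$, and to
    -- $R_sy$ by commutation.
    exact tendsto_nhds_unique h1 h2
  have hgraph : ∀ p : X × X, p ∈ (c • J.closure).graph ↔
      (p.1, c⁻¹ • p.2) ∈ J.graph.topologicalClosure := by
    intro p
    rw [hJ.graph_closure_eq_closure_graph, LinearPMap.mem_graph_iff, LinearPMap.mem_graph_iff]
    refine exists_congr fun y => and_congr_right fun _ => ?_
    exact (eq_inv_smul_iff₀ hc0).symm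
  have heq : N.graph.topologicalClosure = (c • J.closure).graph := by
    have hcl : IsClosed (J.graph.topologicalClosure : Set (X × X)) :=
      J.graph.isClosed_topologicalClosure
    apply le_antisymm
    · intro p hp
      rw [hgraph]
      have hcont : Continuous fun p : X × X => (p.1, c⁻¹ • p.2) := by fun_prop
      exact closure_minimal (fun q hq => hcore' q hq) (hcl.preimage hcont) hp
    · intro p hp
      have hcont : Continuous fun p : X × X => (p.1, c • p.2) := by fun_prop
      have hsub : closure (J.graph : Set (X × X)) ⊆
          (fun p : X × X => (p.1, c • p.2)) ⁻¹' (N.graph.topologicalClosure : Set (X × X)) :=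
        closure_minimal (fun q hq => hcore q hq)
          (N.graph.isClosed_topologicalClosure.preimage hcont)
      have h : (p.1, c • c⁻¹ • p.2) ∈ N.graph.topologicalClosure := hsub ((hgraph p).1 hp)
      rwa [smul_inv_smul₀ hc0] at h
  -- The closure of the graph of $T_\alpha$ has just been exhibited as the graph of an operator.
  have hNc : N.IsClosable := ⟨_, heq⟩
  refine ⟨hJ, hNc, LinearPMap.eq_of_eq_graph ?_⟩
  rw [← hNc.graph_closure_eq_closure_graph, heq]
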